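/- Let $n\ge 1$, $[n]=\{1,\dots,n\}$, and let $u,v\in S_n$. **Combinatorial notation.** For $w\in S_n$ write $w_k=w(k)$, $w[k]=\{w_1,\dots,w_k\}$, and $\ell(w)$ for the number of inversions. The quantum Bruhat graph has vertex set $S_n$ and a directed edge $w\to wt_{ij}$ (for $i<j$) whenever $\ell(wt_{ij})=\ell(w)+1$ or $\ell(wt_{ij})=\ell(w)+1-2(j-i)$; let $\ell(u,v)$ be the length of a shortest directed path from $u$ to $v$. The tilted Bruhat interval is $[u,v]=\{w\in S_n:\ell(u,w)+\ell(w,v)=\ell(u,v)\}$. For $a,b\in[n]$ let $[a,b)_c=\{a,\dots,b-1\}$ if $a\le b$ and $[a,b)_c=\{a,\dots,n\}\cup\{1,\dots,b-1\}$ if $a>b$. For $r\in[n]$ let $<_r$ be the linear order $r<_r r+1<_r\cdots<_r n<_r 1<_r\cdots<_r r-1$, and for $A=\{\alpha_1<_r\cdots<_r\alpha_k\}$, $B=\{\beta_1<_r\cdots<_r\beta_k\}\subseteq[n]$ write $A\le_r B$ if $\alpha_i\le_r\beta_i$ for all $i$. For $\mathbf a=(a_1,\dots,a_n)\in[n]^n$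 write $u\le_{\mathbf a}v$ if $u[k]\le_{a_k}v[k]$ for all $k\in[n]$, and $u\lesssim_{\mathbf a}v$ if moreover $|u[k]\cap[a_k,a_{k+1})_c|=|v[k]\cap[a_k,a_{k+1})_c|$ for all $k\in[n-1]$. **Geometric notation.** Let $\mathrm{Fl}_n$ be the variety of complete flags $F_\bullet=(F_1\subset\cdots\subset F_n=\mathbb C^n)$, and let $M_F\in GL_n(\mathbb C)$ be a matrix whose first $k$ columns span $F_k$ for every $k$. Let $\mathrm{rank}_S(F_k)$ be the rank of the submatrix of $M_F$ with rows $S$ and the first $k$ columns. Let $\Delta_I(F_\bullet)$ be the minor of $M_F$ with rows $I$ and the first $|I|$ columns (its vanishing does not depend on $M_F$, nor on the ordering of the rows), and let $\Delta_w=\prod_{k=1}^n\Delta_{w[k]}$. Define $$\mathcal T_{u,v,\mathbf a}=\{F_\bullet:\ \mathrm{rank}_{[a_k,i)_c}(F_k)\le|u[k]\cap[a_k,i)_c|,\ \ \mathrm{rank}_{[i,a_k)_c}(F_k)\le|v[k]\cap[i,a_k)_c|\ \ \forall i,k\in[n]\},$$ and define $\mathcal T^\circ_{u,v,\mathbf a}$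 in the same way with equalities in place of the inequalities. For $I,J\subseteq[n]$ with $|I|=|J|=k$ let $\mathcal R_{I,J}$ be the Grassmannian Richardson variety: the set of $V\in\mathrm{Gr}_{k,n}$ with $\mathrm{rank}_{\{i,\dots,n\}}(V)\le|J\cap\{i,\dots,n\}|$ and $\mathrm{rank}_{\{1,\dots,i\}}(V)\le|I\cap\{1,\dots,i\}|$ for all $i\in[n]$; let $\mathcal R^\circ_{I,J}$ be defined with equalities. (Both are empty unless $I\le_1 J$.) Let $\tau$ be the cyclic rotation $i\mapsto i+1$ of $[n]$ (with $n\mapsto1$), acting on subsets of $[n]$ and on $\mathrm{Gr}_{k,n}$ by moving row $i$ of a representing matrix to row $\tau(i)$, and put $\mathcal R_{I,J,r}=\tau^{r-1}(\mathcal R_{\tau^{1-r}(I),\tau^{1-r}(J)})$, $\mathcal R^\circ_{I,J,r}=\tau^{r-1}(\mathcal R^\circ_{\tau^{1-r}(I),\tau^{1-r}(J)})$. Let $\pi_k:\mathrm{Fl}_n\to\mathrm{Gr}_{k,n}$, $F_\bullet\mapsto F_k$. The tilted Schubert cell $X^\circ_{w,\mathbf a}$ is the set of $F_\bullet$ with $\Delta_w(F_\bullet)\ne0$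 and $\Delta_{w[k-1]\cup\{w_i\}}(F_\bullet)=0$ for all $i>k$ with $w_i>_{a_k}w_k$. The opposite tilted Schubert cell $\Omega^\circ_{w,\mathbf a}$ is the set of $F_\bullet$ with $\Delta_w(F_\bullet)\ne0$ and $\Delta_{w[k-1]\cup\{w_i\}}(F_\bullet)=0$ for all $i>k$ with $w_i<_{a_k}w_k$. **Theorem.** 0. There is $\mathbf a\in[n]^n$ with $u\le_{\mathbf a}v$, and $\mathcal T_{u,v,\mathbf a}$ and $\mathcal T^\circ_{u,v,\mathbf a}$ are the same for all such $\mathbf a$. Denote them by $\mathcal T_{u,v}$ and $\mathcal T^\circ_{u,v}$. 1. For every $\mathbf a\in[n]^n$, $$\mathcal T_{u,v,\mathbf a}=\bigcap_{k=1}^{n-1}\pi_k^{-1}(\mathcal R_{u[k],v[k],a_k})\quad\text{and}\quad\mathcal T^\circ_{u,v,\mathbf a}=\bigcap_{k=1}^{n-1}\pi_k^{-1}(\mathcal R^\circ_{u[k],v[k],a_k}).$$ 2. $\mathcal T_{u,v}=\{F_\bullet\in\mathrm{Fl}_n:\Delta_w(F_\bullet)=0\text{ for all }w\notin[u,v]\}$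 and $\mathcal T^\circ_{u,v}=\mathcal T_{u,v}\cap\{\Delta_u\Delta_v\ne0\}$. 3. For every $\mathbf a\in[n]^n$: if $u\le_{\mathbf a}v$, then $\mathcal T^\circ_{u,v}\subseteq X^\circ_{v,\mathbf a}\cap\Omega^\circ_{u,\mathbf a}$; if $u\lesssim_{\mathbf a}v$, then $\mathcal T^\circ_{u,v}=X^\circ_{v,\mathbf a}\cap\Omega^\circ_{u,\mathbf a}$. -/

import Mathlib

noncomputable section

namespace TiltedRichardson

/-! ### Conventions

The set `[n] = {1, …, n}` is represented by `Fin n`, so everything is shifted by one: an index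
`k : Fin n` stands for the index `k + 1` of the usual notation.  A permutation `w` has one-line
notation `w 0, w 1, …`, and `(w * Equiv.swap i j)` is `w t_{ij}` (positions `i`, `j` exchanged). -/

/-! ### Combinatorics: the quantum Bruhat graph and tilted Bruhat intervals -/

/-- The length of a permutation, i.e. its number of inversions. -/
def permLength {n : ℕ} (w : Equiv.Perm (Fin n)) : ℕ :=
  ((Finset.univ : Finset (Fin n × Fin n)).filter (fun p => p.1 < p.2 ∧ w p.2 < w p.1)).card

/-- The edges of the quantum Bruhat graph: `w → w t_{ij}` (for `i < j`) is an edge when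
`ℓ(w t_{ij}) = ℓ(w) + 1` or `ℓ(w t_{ij}) = ℓ(w) + 1 - 2 (j - i)`. -/
def QBGEdge {n : ℕ} (w w' : Equiv.Perm (Fin n)) : Prop :=
  ∃ i j : Fin n, i < j ∧ w' = w * Equiv.swap i j ∧
    (permLength w' = permLength w + 1 ∨
      permLength w' + 2 * ((j : ℕ) - (i : ℕ)) = permLength w + 1)

/-- `QBGPath m u v`: there is a directed path with `m` edges from `u` to `v` in the quantum
Bruhat graph. -/
inductive QBGPath {n : ℕ} : ℕ → Equiv.Perm (Fin n) → Equiv.Perm (Fin n) → Prop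
  | nil (u : Equiv.Perm (Fin n)) : QBGPath 0 u u
  | cons {m : ℕ} {u v w : Equiv.Perm (Fin n)} :
      QBGPath m u v → QBGEdge v w → QBGPath (m + 1) u w

/-- Exchanging two increasing adjacent entries adds one inversion. -/
theorem permLength_mul_swap {n : ℕ} (w : Equiv.Perm (Fin n)) (i j : Fin n)
    (hij : (j : ℕ) = (i : ℕ) + 1) (h : w i < w j) :
    permLength (w * Equiv.swap i j) = permLength w + 1 := by
  have hs : ∀ p q : Fin n, p < q → ¬(p = i ∧ q = j) →
      Equiv.swap i j p < Equiv.swap i j q := by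
    intro p q hpq hne
    simp only [Equiv.swap_apply_def, Fin.ext_iff, Fin.lt_def] at *
    split_ifs <;> omega
  unfold permLength
  set A := (Finset.univ : Finset (Fin n × Fin n)).filter
    (fun p => p.1 < p.2 ∧ w p.2 < w p.1) with hA
  have hinj : Function.Injective
      (fun p : Fin n × Fin n => (Equiv.swap i j p.1, Equiv.swap i j p.2)) := by
    rintro ⟨a, b⟩ ⟨c, d⟩ hh
    simpa using hh
  have hset : (Finset.univ : Finset (Fin n × Fin n)).filter
      (fun p => p.1 < p.2 ∧ (w * Equiv.swap i j) p.2 < (w * Equiv.swap i j) p.1) =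
      insert (i, j) (A.image fun p => (Equiv.swap i j p.1, Equiv.swap i j p.2)) := by
    ext ⟨p, q⟩
    rw [Finset.mem_filter]
    simp only [Finset.mem_filter, Finset.mem_univ, true_and, Equiv.Perm.mul_apply,
      Finset.mem_insert, Finset.mem_image, Prod.mk.injEq, hA, Prod.exists]
    constructor
    · rintro ⟨hpq, hw⟩
      by_cases hc : p = i ∧ q = j
      · exact Or.inl hc
      · exact Or.inr ⟨_, _, ⟨hs p q hpq hc, hw⟩, Equiv.swap_apply_self _ _ _,
          Equiv.swap_apply_self _ _ _⟩
    · rintro (⟨rfl, rfl⟩ | ⟨c, d, ⟨hcd, hw⟩, rfl, rfl⟩)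
      · refine ⟨by rw [Fin.lt_def]; omega, ?_⟩
        simpa using h
      · refine ⟨hs c d hcd ?_, by simpa using hw⟩
        rintro ⟨rfl, rfl⟩
        exact lt_asymm h hw
  have hnot : (i, j) ∉ A.image fun p => (Equiv.swap i j p.1, Equiv.swap i j p.2) := by
    simp only [Finset.mem_image, Prod.mk.injEq, Prod.exists, not_exists, not_and, hA,
      Finset.mem_filter, Finset.mem_univ, true_and]
    rintro c d ⟨hcd, -⟩ h1 h2
    have hc : c = j := by
      rw [← Equiv.swap_apply_self i j c, h1, Equiv.swap_apply_left]
    have hd : d = i := by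
      rw [← Equiv.swap_apply_self i j d, h2, Equiv.swap_apply_right]
    subst hc hd
    rw [Fin.lt_def] at hcd
    omega
  rw [hset, Finset.card_insert_of_notMem hnot, Finset.card_image_of_injective _ hinj]

/-- The quantum Bruhat graph is strongly connected, so shortest paths exist. -/
theorem exists_qbgPath {n : ℕ} (u v : Equiv.Perm (Fin n)) : ∃ m, QBGPath m u v := by
  have hedge : ∀ (w : Equiv.Perm (Fin n)) (i j : Fin n), (j : ℕ) = (i : ℕ) + 1 →
      QBGEdge w (w * Equiv.swap i j) := by
    intro w i j hij
    have hlt : i < j := by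
      rw [Fin.lt_def]
      omega
    refine ⟨i, j, hlt, rfl, ?_⟩
    rcases lt_or_ge (w i) (w j) with h | h
    · exact Or.inl (permLength_mul_swap w i j hij h)
    · have h' : w j < w i := lt_of_le_of_ne h fun hh => hlt.ne' (w.injective hh)
      have := permLength_mul_swap (w * Equiv.swap i j) i j hij (by simpa using h')
      rw [mul_assoc, Equiv.swap_mul_self, mul_one] at this
      right
      omega
  cases n with
  | zero => exact ⟨0, Subsingleton.elim u v ▸ QBGPath.nil u⟩
  | succ n =>
    have hmem : u⁻¹ * v ∈ Submonoid.closure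
        (Set.range fun i : Fin n => Equiv.swap i.castSucc i.succ) := by
      rw [Equiv.Perm.mclosure_swap_castSucc_succ]
      trivial
    have key : ∀ x ∈ Submonoid.closure
        (Set.range fun i : Fin n => Equiv.swap i.castSucc i.succ),
        ∃ m, QBGPath m u (u * x) := by
      intro x hx
      induction hx using Submonoid.closure_induction_right with
      | one => exact ⟨0, by simpa using QBGPath.nil u⟩
      | mul_right x hx y hy ih =>
        obtain ⟨i, rfl⟩ := hy
        obtain ⟨m, hm⟩ := ih
        refine ⟨m + 1, QBGPath.cons hm ?_⟩
        rw [← mul_assoc]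
        exact hedge _ _ _ (by simp)
    simpa using key _ hmem

/-- `ℓ(u, v)`: the length of a shortest directed path from `u` to `v` in the quantum Bruhat
graph (such a path always exists, see `exists_qbgPath`). -/
def qbgDist {n : ℕ} (u v : Equiv.Perm (Fin n)) : ℕ :=
  sInf {m : ℕ | QBGPath m u v}

/-- The tilted Bruhat interval `[u, v]`. -/
def tiltedInterval {n : ℕ} (u v : Equiv.Perm (Fin n)) : Set (Equiv.Perm (Fin n)) :=
  {w | qbgDist u w + qbgDist w v = qbgDist u v}

/-! ### Combinatorics: tilted Bruhat orders -/

/-- The cyclic interval `[a, b)_c`. -/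
def cyclicIco {n : ℕ} (a b : Fin n) : Finset (Fin n) :=
  if a ≤ b then Finset.Ico a b else Finset.Ici a ∪ Finset.Iio b

/-- The shifted linear order `x ≤_r y`, in which `r < r + 1 < ⋯ < n < 1 < ⋯ < r - 1`; the
difference `x - r` is taken modulo `n`. -/
def shiftedLE {n : ℕ} (r x y : Fin n) : Prop := x - r ≤ y - r

/-- The strict shifted linear order `x <_r y`. -/
def shiftedLT {n : ℕ} (r x y : Fin n) : Prop := x - r < y - r

/-- The shifted Gale order `A ≤_r B` on subsets of the same cardinality:
`A = {α₁ <_r ⋯ <_r α_m}`, `B = {β₁ <_r ⋯ <_r β_m}` and `α_i ≤_r β_i` for all `i`. -/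
def shiftedGaleLE {n : ℕ} (r : Fin n) (A B : Finset (Fin n)) : Prop :=
  ∃ (m : ℕ) (α β : Fin m → Fin n),
    (∀ i j, i < j → shiftedLT r (α i) (α j)) ∧ (∀ i j, i < j → shiftedLT r (β i) (β j)) ∧
    Finset.univ.image α = A ∧ Finset.univ.image β = B ∧ ∀ i, shiftedLE r (α i) (β i)

/-- The set `w[k]` of the values of `w` at the positions up to and including `k`. -/
def prefixSet {n : ℕ} (w : Equiv.Perm (Fin n)) (k : Fin n) : Finset (Fin n) :=
  (Finset.Iic k).image w

/-- The `a`-tilted Bruhat order `u ≤_a v`. -/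
def tiltedLE {n : ℕ} (a : Fin n → Fin n) (u v : Equiv.Perm (Fin n)) : Prop :=
  ∀ k : Fin n, shiftedGaleLE (a k) (prefixSet u k) (prefixSet v k)

/-- The equivalence relation `u ∼_a v`.  (For the last position there is no next entry of `a`,
and the condition would be void there since `u[n] = v[n] = [n]`.) -/
def tiltedSim {n : ℕ} (a : Fin n → Fin n) (u v : Equiv.Perm (Fin n)) : Prop :=
  ∀ k k' : Fin n, (k' : ℕ) = (k : ℕ) + 1 →
    (prefixSet u k ∩ cyclicIco (a k) (a k')).card = (prefixSet v k ∩ cyclicIco (a k) (a k')).card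

/-- The `a`-tilted Bruhat order modulo `∼_a`, written `u ≲_a v`. -/
def tiltedLesssim {n : ℕ} (a : Fin n → Fin n) (u v : Equiv.Perm (Fin n)) : Prop :=
  tiltedLE a u v ∧ tiltedSim a u v

/-! ### The flag variety and Grassmannians -/

/-- Complete flags in `ℂⁿ`: `space k` is the member of dimension `k + 1`. -/
@[ext]
structure CompleteFlag (n : ℕ) where
  space : Fin n → Submodule ℂ (Fin n → ℂ)
  mono : Monotone space
  finrank_space : ∀ k, Module.finrank ℂ (space k) = (k : ℕ) + 1

/-- `M` is a matrix representative of the flag `F`: each member of the flag is spanned by the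
corresponding number of leading columns of `M` (so `M` is automatically invertible). -/
def CompleteFlag.IsRep {n : ℕ} (F : CompleteFlag n) (M : Matrix (Fin n) (Fin n) ℂ) : Prop :=
  ∀ k : Fin n, F.space k = Submodule.span ℂ ((fun j i => M i j) '' Set.Iic k)

/-- The Grassmannian of `k`-dimensional subspaces of `ℂⁿ`. -/
def Gr (k n : ℕ) : Type := {V : Submodule ℂ (Fin n → ℂ) // Module.finrank ℂ V = k}

/-- The projection from the flag variety to a Grassmannian. -/
def CompleteFlag.proj {n : ℕ} (k : Fin n) (F : CompleteFlag n) : Gr ((k : ℕ) + 1) n :=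
  ⟨F.space k, F.finrank_space k⟩

/-- `rank_S(V)`: the dimension of the image of `V` under the projection to the coordinates in `S`,
that is, the rank of the submatrix with rows in `S` of any matrix whose columns span `V`
(see `rankOn_eq_rank_submatrix`). -/
def rankOn {n : ℕ} (S : Finset (Fin n)) (V : Submodule ℂ (Fin n → ℂ)) : ℕ :=
  Module.finrank ℂ (V.map (LinearMap.funLeft ℂ ℂ (Subtype.val : S → Fin n)))

/-! ### Tilted Richardson varieties by rank conditions -/

/-- The tilted Richardson variety `T_{u,v,a}`. -/
def tiltedRichardsonAt {n : ℕ} (u v : Equiv.Perm (Fin n)) (a : Fin n → Fin n) :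
    Set (CompleteFlag n) :=
  {F | ∀ i k : Fin n,
    rankOn (cyclicIco (a k) i) (F.space k) ≤ (prefixSet u k ∩ cyclicIco (a k) i).card ∧
    rankOn (cyclicIco i (a k)) (F.space k) ≤ (prefixSet v k ∩ cyclicIco i (a k)).card}

/-- The open tilted Richardson variety `T°_{u,v,a}`. -/
def openTiltedRichardsonAt {n : ℕ} (u v : Equiv.Perm (Fin n)) (a : Fin n → Fin n) :
    Set (CompleteFlag n) :=
  {F | ∀ i k : Fin n,
    rankOn (cyclicIco (a k) i) (F.space k) = (prefixSet u k ∩ cyclicIco (a k) i).card ∧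
    rankOn (cyclicIco i (a k)) (F.space k) = (prefixSet v k ∩ cyclicIco i (a k)).card}

/-- The tilted Richardson variety `T_{u,v}`: it is `T_{u,v,a}` for any `a` with `u ≤_a v`.  (Such
sequences exist and the choice does not matter; the main theorem asserts this as well.) -/
def tiltedRichardson {n : ℕ} (u v : Equiv.Perm (Fin n)) : Set (CompleteFlag n) :=
  {F | ∃ a : Fin n → Fin n, tiltedLE a u v ∧ F ∈ tiltedRichardsonAt u v a}

/-- The open tilted Richardson variety `T°_{u,v}`: it is `T°_{u,v,a}` for any `a` with
`u ≤_a v`. -/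
def openTiltedRichardson {n : ℕ} (u v : Equiv.Perm (Fin n)) : Set (CompleteFlag n) :=
  {F | ∃ a : Fin n → Fin n, tiltedLE a u v ∧ F ∈ openTiltedRichardsonAt u v a}

/-! ### Cyclically rotated Grassmannian Richardson varieties -/

/-- The Grassmannian Schubert variety `X_I` (ranks of the sets `{i, …, n}` of last rows). -/
def grSchubert {n : ℕ} (k : ℕ) (I : Finset (Fin n)) : Set (Gr k n) :=
  {V | ∀ i : Fin n, rankOn (Finset.Ici i) V.1 ≤ (I ∩ Finset.Ici i).card}

/-- The Grassmannian Schubert cell `X°_I`. -/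
def grSchubertCell {n : ℕ} (k : ℕ) (I : Finset (Fin n)) : Set (Gr k n) :=
  {V | ∀ i : Fin n, rankOn (Finset.Ici i) V.1 = (I ∩ Finset.Ici i).card}

/-- The opposite Grassmannian Schubert variety `Ω_I` (ranks of the sets `{1, …, i}`). -/
def grOppSchubert {n : ℕ} (k : ℕ) (I : Finset (Fin n)) : Set (Gr k n) :=
  {V | ∀ i : Fin n, rankOn (Finset.Iic i) V.1 ≤ (I ∩ Finset.Iic i).card}

/-- The opposite Grassmannian Schubert cell `Ω°_I`. -/
def grOppSchubertCell {n : ℕ} (k : ℕ) (I : Finset (Fin n)) : Set (Gr k n) :=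
  {V | ∀ i : Fin n, rankOn (Finset.Iic i) V.1 = (I ∩ Finset.Iic i).card}

/-- The Grassmannian Richardson variety `R_{I,J} = X_J ∩ Ω_I`. -/
def grRichardson {n : ℕ} (k : ℕ) (I J : Finset (Fin n)) : Set (Gr k n) :=
  grSchubert k J ∩ grOppSchubert k I

/-- The open Grassmannian Richardson variety `R°_{I,J} = X°_J ∩ Ω°_I`. -/
def grOpenRichardson {n : ℕ} (k : ℕ) (I J : Finset (Fin n)) : Set (Gr k n) :=
  grSchubertCell k J ∩ grOppSchubertCell k I

/-- The cyclic rotation `τ` of the Grassmannian: row `i + 1` of `τ(M)` is row `i` of `M`, and the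
first row of `τ(M)` is the last row of `M`. -/
def grRotate {k n : ℕ} (V : Gr k n) : Gr k n :=
  ⟨V.1.map (LinearEquiv.funCongrLeft ℂ ℂ (finRotate n).symm).toLinearMap, by
    rw [LinearEquiv.finrank_map_eq]; exact V.2⟩

/-- The `m`-fold inverse cyclic rotation `τ^{-m}(I)` of an index set. -/
def rotateSetInv {n : ℕ} (m : ℕ) (I : Finset (Fin n)) : Finset (Fin n) :=
  I.image ((finRotate n).symm^[m])

/-- The cyclically rotated Grassmannian Richardson variety
`R_{I,J,r} = τ^{r-1}(R_{τ^{1-r}(I), τ^{1-r}(J)})`; the value of `r : Fin n` is `r - 1` in the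
usual numbering. -/
def rotatedRichardson {n : ℕ} (k : ℕ) (I J : Finset (Fin n)) (r : Fin n) : Set (Gr k n) :=
  (grRotate^[(r : ℕ)]) '' grRichardson k (rotateSetInv r I) (rotateSetInv r J)

/-- The cyclically rotated open Grassmannian Richardson variety `R°_{I,J,r}`. -/
def rotatedOpenRichardson {n : ℕ} (k : ℕ) (I J : Finset (Fin n)) (r : Fin n) : Set (Gr k n) :=
  (grRotate^[(r : ℕ)]) '' grOpenRichardson k (rotateSetInv r I) (rotateSetInv r J)

/-! ### Plücker coordinates -/

/-- The minor `Δ_{ρ_1, …, ρ_k}(M)` with rows `ρ_1, …, ρ_k`, in this order, and the first `k`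
columns of `M` (in the shifted numbering, rows `ρ 0, …, ρ k` and columns `0, …, k`). -/
def leadingMinor {n : ℕ} (M : Matrix (Fin n) (Fin n) ℂ) (ρ : Fin n → Fin n) (k : Fin n) : ℂ :=
  (M.submatrix (fun i : Fin ((k : ℕ) + 1) => ρ (Fin.castLE k.isLt i))
    (fun j : Fin ((k : ℕ) + 1) => Fin.castLE k.isLt j)).det

/-- The definition of `rankOn` agrees with the rank of a submatrix of a matrix representative. -/
theorem rankOn_eq_rank_submatrix {n m : ℕ} (S : Finset (Fin n)) (V : Submodule ℂ (Fin n → ℂ))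
    (M : Matrix (Fin n) (Fin m) ℂ) (hM : V = Submodule.span ℂ (Set.range fun j i => M i j)) :
    rankOn S V = (M.submatrix (Subtype.val : S → Fin n) id).rank := by
  rw [Matrix.rank_eq_finrank_span_cols, rankOn, hM, Submodule.map_span, ← Set.range_comp]
  rfl

/-- Every complete flag has a matrix representative. -/
theorem CompleteFlag.exists_isRep {n : ℕ} (F : CompleteFlag n) : ∃ M, F.IsRep M := by
  have key : ∀ k : Fin n, ∃ x ∈ F.space k, ∃ W : Submodule ℂ (Fin n → ℂ),
      (∀ j < k, F.space j ≤ W) ∧ x ∉ W := by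
    intro k
    by_cases hk : (k : ℕ) = 0
    · have hne : F.space k ≠ ⊥ := by
        intro h
        have := F.finrank_space k
        rw [h, finrank_bot] at this
        omega
      obtain ⟨x, hx, hx0⟩ := Submodule.exists_mem_ne_zero_of_ne_bot hne
      refine ⟨x, hx, ⊥, fun j hj => ?_, by simpa using hx0⟩
      have : (j : ℕ) < k := hj
      omega
    · have hlt : (k : ℕ) - 1 < n := by omega
      have hnot : ¬ F.space k ≤ F.space ⟨(k : ℕ) - 1, hlt⟩ := by
        intro h
        have h1 := Submodule.finrank_mono h
        rw [F.finrank_space, F.finrank_space] at h1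
        simp only at h1
        omega
      obtain ⟨x, hx, hxp⟩ := SetLike.not_le_iff_exists.mp hnot
      refine ⟨x, hx, _, fun j hj => F.mono ?_, hxp⟩
      have : (j : ℕ) < k := hj
      show (j : ℕ) ≤ (k : ℕ) - 1
      omega
  choose x hx W hW hxW using key
  have hrank : ∀ m : ℕ, m ≤ n →
      m ≤ Module.finrank ℂ (Submodule.span ℂ (x '' {j : Fin n | (j : ℕ) < m})) := by
    intro m
    induction m with
    | zero => intro _; exact Nat.zero_le _
    | succ m ih =>
      intro hm
      refine (Nat.succ_le_succ (ih (by omega))).trans ?_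
      refine Nat.succ_le_of_lt (Submodule.finrank_lt_finrank_of_lt ?_)
      refine lt_of_le_of_ne (Submodule.span_mono (Set.image_mono fun j hj => ?_)) ?_
      · have : (j : ℕ) < m := hj
        show (j : ℕ) < m + 1
        omega
      · intro heq
        have h1 : x ⟨m, hm⟩ ∈ Submodule.span ℂ (x '' {j : Fin n | (j : ℕ) < m}) := by
          rw [heq]
          exact Submodule.subset_span ⟨_, Nat.lt_succ_self m, rfl⟩
        refine hxW ⟨m, hm⟩ (Submodule.span_le.mpr ?_ h1)
        rintro _ ⟨j, hj, rfl⟩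
        exact hW _ j hj (hx j)
  refine ⟨fun i j => x j i, fun k => ?_⟩
  have hset : Set.Iic k = {j : Fin n | (j : ℕ) < (k : ℕ) + 1} := by
    ext j
    exact Nat.lt_succ_iff.symm
  have hr := hrank ((k : ℕ) + 1) k.isLt
  rw [← hset] at hr
  symm
  refine Submodule.eq_of_le_of_finrank_le ?_ (by rw [F.finrank_space]; exact hr)
  rw [Submodule.span_le]
  rintro _ ⟨j, hj, rfl⟩
  exact F.mono hj (hx j)

/-- The (non)vanishing of a Plücker coordinate does not depend on the matrix representative. -/
theorem CompleteFlag.IsRep.leadingMinor_ne_zero_iff {n : ℕ} {F : CompleteFlag n}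
    {M : Matrix (Fin n) (Fin n) ℂ} (hM : F.IsRep M) (ρ : Fin n → Fin n) (k : Fin n) :
    leadingMinor M ρ k ≠ 0 ↔
      (F.space k).map (LinearMap.funLeft ℂ ℂ
        (fun i : Fin ((k : ℕ) + 1) => ρ (Fin.castLE k.isLt i))) = ⊤ := by
  have himg : Set.Iic k = Set.range (fun j : Fin ((k : ℕ) + 1) => Fin.castLE k.isLt j) := by
    ext j
    constructor
    · intro hj
      exact ⟨⟨j, Nat.lt_succ_of_le hj⟩, rfl⟩
    · rintro ⟨i, rfl⟩
      exact Nat.le_of_lt_succ i.isLt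
  rw [leadingMinor, ← isUnit_iff_ne_zero, ← Matrix.isUnit_iff_isUnit_det,
    ← Matrix.mulVec_surjective_iff_isUnit, hM k, Submodule.map_span, himg, ← Set.range_comp,
    ← Set.range_comp]
  have h := Matrix.range_mulVecLin (M.submatrix
    (fun i : Fin ((k : ℕ) + 1) => ρ (Fin.castLE k.isLt i))
    (fun j : Fin ((k : ℕ) + 1) => Fin.castLE k.isLt j))
  refine Iff.trans ?_ (Eq.congr_left h)
  rw [LinearMap.range_eq_top]
  rfl

/-- A chosen matrix representative `M_F` of a flag. -/
def CompleteFlag.rep {n : ℕ} (F : CompleteFlag n) : Matrix (Fin n) (Fin n) ℂ :=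
  F.exists_isRep.choose

theorem CompleteFlag.isRep_rep {n : ℕ} (F : CompleteFlag n) : F.IsRep F.rep :=
  F.exists_isRep.choose_spec

/-- The Plücker coordinate `Δ_{ρ_1, …, ρ_k}(F)`, computed from the chosen matrix representative.
Only its (non)vanishing is used, and this is independent of the representative. -/
def plucker {n : ℕ} (F : CompleteFlag n) (ρ : Fin n → Fin n) (k : Fin n) : ℂ :=
  leadingMinor F.rep ρ k

theorem plucker_eq_zero_iff {n : ℕ} (F : CompleteFlag n) {M : Matrix (Fin n) (Fin n) ℂ}
    (hM : F.IsRep M) (ρ : Fin n → Fin n) (k : Fin n) :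
    plucker F ρ k = 0 ↔ leadingMinor M ρ k = 0 :=
  not_iff_not.mp ((F.isRep_rep.leadingMinor_ne_zero_iff ρ k).trans
    (hM.leadingMinor_ne_zero_iff ρ k).symm)

/-- The multi-Plücker coordinate `Δ_w(F) = ∏_k Δ_{w[k]}(F)`. -/
def multiPlucker {n : ℕ} (F : CompleteFlag n) (w : Equiv.Perm (Fin n)) : ℂ :=
  ∏ k : Fin n, plucker F w k

/-! ### Tilted Schubert cells -/

/-- The tilted Rothe diagram `D_a(w) = {(w_i, k) : i > k, w_i <_{a_k} w_k}`. -/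
def tiltedRothe {n : ℕ} (a : Fin n → Fin n) (w : Equiv.Perm (Fin n)) : Set (Fin n × Fin n) :=
  {p | ∃ i k : Fin n, p = (w i, k) ∧ k < i ∧ shiftedLT (a k) (w i) (w k)}

/-- The opposite tilted Rothe diagram `D_a^op(w) = {(w_i, k) : i > k, w_i >_{a_k} w_k}`. -/
def tiltedRotheOp {n : ℕ} (a : Fin n → Fin n) (w : Equiv.Perm (Fin n)) : Set (Fin n × Fin n) :=
  {p | ∃ i k : Fin n, p = (w i, k) ∧ k < i ∧ shiftedLT (a k) (w k) (w i)}

/-- The tilted Schubert cell `X°_{w,a}`.  The coordinate `Δ_{w[k-1] ∪ {i}}` has rows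
`w_1, …, w_{k-1}, i`, that is, `w` with its entry at position `k` replaced by `i`. -/
def tiltedSchubertCell {n : ℕ} (w : Equiv.Perm (Fin n)) (a : Fin n → Fin n) :
    Set (CompleteFlag n) :=
  {F | multiPlucker F w ≠ 0 ∧
    ∀ i k : Fin n, (i, k) ∈ tiltedRotheOp a w → plucker F (Function.update w k i) k = 0}

/-- The opposite tilted Schubert cell `Ω°_{w,a}`. -/
def oppTiltedSchubertCell {n : ℕ} (w : Equiv.Perm (Fin n)) (a : Fin n → Fin n) :
    Set (CompleteFlag n) :=
  {F | multiPlucker F w ≠ 0 ∧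
    ∀ i k : Fin n, (i, k) ∈ tiltedRothe a w → plucker F (Function.update w k i) k = 0}

end TiltedRichardson

end

open TiltedRichardson

/-!
For subsets `A`, `B` of `Fin n` of the same size, let `gap A B x` be the number of elements of `B`
below `x` minus the number of elements of `A` below `x`, and let `degree A B` be its maximum over
`x`. Counting elements in cyclic segments shows that `A ≤_r B` holds exactly when `gap A B` attains
its maximum at `r` (`shiftedGaleLE_iff`). So some `r` always works, which gives a sequence `a` with
`u ≤_a v`; and since `gap A B + gap B C = gap A C`, for `A ≤_r C` one has `A ≤_r B ≤_r C` exactly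
when `degree A B + degree B C = degree A C` (`degree_add_iff`), a condition free of `r`.

Put `degreeDist u v = ℓ(v) - ℓ(u) + 2 ∑_k degree (u[k], v[k])`. It satisfies the triangle
inequality and is at most `1` on the edges of the quantum Bruhat graph, so it is at most the
distance. Conversely, if `i` is the first position at which `u` and `v` differ and `j` is the next
position whose entry lies in the cyclic interval from `u i` to `v i`, then `u → u t_{ij}` is an edge
which lowers `degreeDist` by one (`exists_edge_degreeDist`). Hence `degreeDist` is the distance
(`qbgDist_eq`), and `w ∈ [u, v]` if and only if `u ≤_a w ≤_a v`, for any `a` with `u ≤_a v`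
(`mem_tiltedInterval_iff`).

On the geometric side, `S ↦ rankOn S V` is the rank function of the matroid of rows of `V`, whose
bases are the nonvanishing Plücker coordinates. A bound on the rank of `S` is a bound on the size
of `B ∩ S` for all bases `B`, so the rank conditions at position `k` say that every basis lies
between `u[k]` and `v[k]` for `≤_{a_k}` (`segmentRanksLE_iff`). A basis of one member of a flag
extends to a chain of bases along the flag, that is, to a permutation `w` with `Δ_w ≠ 0`
(`CompleteFlag.exists_perm`). With the description of tilted intervals, this turns the rank
conditions into the vanishing of `Δ_w` for `w ∉ [u, v]`; this does not involve `a`. Equalities of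
ranks say in addition that `u[k]` and `v[k]`, the greedy bases for `<_{a_k}` and its reverse, are
bases (`segmentRanksEq_iff`).

For tilted Schubert cells, a nonvanishing coordinate excluded by the definition of the cell would
be a basis that violates a rank condition. In the other direction the rank conditions are proved by
induction along the flag (`segmentRanksLE_of_mem_cells`): `u ∼_a v` says that `gap` takes the same
value at `a_k` and at `a_{k+1}`, so that the conditions on `F_k` may be taken with respect to
`a_{k+1}`, and the vanishing coordinates carry them over to `F_{k+1}`.
-/

namespace TiltedRichardson

/-! ### The matroid of row ranks -/

/-- The row vectors of a matrix whose columns form a basis of `V`: they represent the matroid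
with rank function `fun S => rankOn S V`. -/
theorem exists_rows {n : ℕ} (V : Submodule ℂ (Fin n → ℂ)) :
    ∃ φ : Fin n → (Fin (Module.finrank ℂ V) → ℂ), ∀ S : Finset (Fin n),
      rankOn S V = Module.finrank ℂ (Submodule.span ℂ (φ '' (S : Set (Fin n)))) := by
  let b := Module.finBasis ℂ V
  let M : Matrix (Fin n) (Fin (Module.finrank ℂ V)) ℂ := fun i j => (b j : Fin n → ℂ) i
  refine ⟨M, fun S => ?_⟩
  have hV : V = Submodule.span ℂ (Set.range fun j i => M i j) := by
    have h := congrArg (Submodule.map V.subtype) b.span_eq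
    rw [Submodule.map_span, ← Set.range_comp, Submodule.map_top, Submodule.range_subtype] at h
    exact h.symm
  rw [rankOn_eq_rank_submatrix S V M hV, Matrix.rank_eq_finrank_span_row]
  have hr : Set.range (M.submatrix (Subtype.val : S → Fin n) id).row = M '' (S : Set (Fin n)) := by
    rw [Set.image_eq_range]
    rfl
  rw [hr]

theorem rankOn_mono_left {n : ℕ} {S T : Finset (Fin n)} (h : S ⊆ T)
    (V : Submodule ℂ (Fin n → ℂ)) : rankOn S V ≤ rankOn T V := by
  obtain ⟨φ, hφ⟩ := exists_rows V
  rw [hφ, hφ]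
  exact Submodule.finrank_mono (Submodule.span_mono (Set.image_mono (by exact_mod_cast h)))

theorem rankOn_mono_right {n : ℕ} (S : Finset (Fin n)) {V W : Submodule ℂ (Fin n → ℂ)}
    (h : V ≤ W) : rankOn S V ≤ rankOn S W :=
  Submodule.finrank_mono (Submodule.map_mono h)

theorem rankOn_le_card {n : ℕ} (S : Finset (Fin n)) (V : Submodule ℂ (Fin n → ℂ)) :
    rankOn S V ≤ S.card := by
  have := Submodule.finrank_le (V.map (LinearMap.funLeft ℂ ℂ (Subtype.val : S → Fin n)))
  simpa [rankOn] using this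

theorem rankOn_le_finrank {n : ℕ} (S : Finset (Fin n)) (V : Submodule ℂ (Fin n → ℂ)) :
    rankOn S V ≤ Module.finrank ℂ V :=
  Submodule.finrank_map_le _ _

theorem rankOn_univ {n : ℕ} (V : Submodule ℂ (Fin n → ℂ)) :
    rankOn Finset.univ V = Module.finrank ℂ V := by
  have hinj : Function.Injective
      (LinearMap.funLeft ℂ ℂ (Subtype.val : ↥(Finset.univ : Finset (Fin n)) → Fin n)) :=
    LinearMap.funLeft_injective_of_surjective _ _ _ fun x => ⟨⟨x, Finset.mem_univ x⟩, rfl⟩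
  exact (Submodule.equivMapOfInjective _ hinj V).finrank_eq.symm

/-- The rank on `S` of a hyperplane of `W` drops by at most one. -/
theorem rankOn_le_add_one {n : ℕ} (S : Finset (Fin n)) {V W : Submodule ℂ (Fin n → ℂ)}
    (h : V ≤ W) (hVW : Module.finrank ℂ W = Module.finrank ℂ V + 1) :
    rankOn S W ≤ rankOn S V + 1 := by
  have hnot : ¬ W ≤ V := fun hh => by
    have := Submodule.finrank_mono hh
    omega
  obtain ⟨c, hcW, hcV⟩ := SetLike.not_le_iff_exists.mp hnot
  have hlt : V < V ⊔ Submodule.span ℂ {c} := by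
    refine lt_of_le_of_ne le_sup_left fun hh => hcV ?_
    rw [hh]
    exact Submodule.mem_sup_right (Submodule.mem_span_singleton_self c)
  have hW : V ⊔ Submodule.span ℂ {c} = W := by
    refine Submodule.eq_of_le_of_finrank_le
      (sup_le h ((Submodule.span_singleton_le_iff_mem _ _).2 hcW)) ?_
    have := Submodule.finrank_lt_finrank_of_lt hlt
    omega
  rw [rankOn, rankOn, ← hW, Submodule.map_sup]
  refine (Submodule.finrank_add_le_finrank_add_finrank _ _).trans ?_
  gcongr
  refine (Submodule.finrank_map_le _ _).trans ?_
  exact (finrank_span_le_card _).trans (by simp)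

/-- If the rows in `T` have full rank on `W`, then restriction to `T` is injective on `W`, hence
on every subspace of `W`. -/
theorem rankOn_eq_finrank_of_le {n : ℕ} {T : Finset (Fin n)} {V W : Submodule ℂ (Fin n → ℂ)}
    (h : V ≤ W) (hW : rankOn T W = Module.finrank ℂ W) :
    rankOn T V = Module.finrank ℂ V := by
  set f := LinearMap.funLeft ℂ ℂ (Subtype.val : T → Fin n) with hf
  have hk := (f.domRestrict W).finrank_range_add_finrank_ker
  rw [LinearMap.range_domRestrict] at hk
  have hker : LinearMap.ker (f.domRestrict W) = ⊥ := by
    rw [← Submodule.finrank_eq_zero (R := ℂ)]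
    have : Module.finrank ℂ (W.map f) = Module.finrank ℂ W := hW
    omega
  have hinj : Function.Injective (f.domRestrict V) :=
    (LinearMap.ker_eq_bot.1 hker).comp (Submodule.inclusion_injective h)
  have := LinearMap.finrank_range_of_inj hinj
  rw [LinearMap.range_domRestrict] at this
  exact this

/-- Independent sets of rows extend to bases. -/
theorem exists_indep_extension {n : ℕ} (V : Submodule ℂ (Fin n → ℂ)) {I T : Finset (Fin n)}
    (hIT : I ⊆ T) (hI : rankOn I V = I.card) :
    ∃ J, I ⊆ J ∧ J ⊆ T ∧ rankOn J V = J.card ∧ J.card = rankOn T V := by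
  obtain ⟨φ, hφ⟩ := exists_rows V
  have key : ∀ S : Finset (Fin n), rankOn S V = S.card ↔ LinearIndepOn ℂ φ (S : Set (Fin n)) := by
    intro S
    have hr : Set.range (fun x : (S : Set (Fin n)) => φ x) = φ '' (S : Set (Fin n)) := by
      rw [Set.image_eq_range]
    rw [hφ, LinearIndepOn, linearIndependent_iff_card_eq_finrank_span, Set.finrank, hr]
    simp [eq_comm]
  obtain ⟨b, hbT, hIb, hspan, hb⟩ :=
    exists_linearIndepOn_extension ((key I).1 hI) (by exact_mod_cast hIT : (I : Set (Fin n)) ⊆ T)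
  obtain ⟨J, rfl⟩ : ∃ J : Finset (Fin n), (J : Set (Fin n)) = b := b.toFinite.exists_finset_coe
  have hJT : J ⊆ T := by exact_mod_cast hbT
  refine ⟨J, by exact_mod_cast hIb, hJT, (key J).2 hb, ?_⟩
  rw [← (key J).2 hb]
  refine le_antisymm (rankOn_mono_left hJT V) ?_
  rw [hφ, hφ]
  exact Submodule.finrank_mono (Submodule.span_le.2 hspan)

theorem rankOn_eq_card_of_subset {n : ℕ} {V : Submodule ℂ (Fin n → ℂ)} {I J : Finset (Fin n)}
    (hIJ : I ⊆ J) (hJ : rankOn J V = J.card) : rankOn I V = I.card := by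
  obtain ⟨φ, hφ⟩ := exists_rows V
  refine le_antisymm (rankOn_le_card I V) ?_
  have hunion : (J : Set (Fin n)) = (I : Set (Fin n)) ∪ ((J \ I : Finset (Fin n)) : Set (Fin n)) := by
    rw [← Finset.coe_union, Finset.union_sdiff_of_subset hIJ]
  have hle : rankOn J V ≤ rankOn I V + rankOn (J \ I) V := by
    rw [hφ, hφ, hφ, hunion, Set.image_union, Submodule.span_union]
    exact Submodule.finrank_add_le_finrank_add_finrank _ _
  have h1 := rankOn_le_card (J \ I) V
  have h2 := Finset.card_sdiff_add_card_eq_card hIJ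
  omega

/-! ### Bases of the row matroid -/

/-- `B` is a basis of the matroid of rows of `V`, that is, the Plücker coordinate `Δ_B` does not
vanish at `V`. -/
def IsRowBasis {n : ℕ} (V : Submodule ℂ (Fin n → ℂ)) (B : Finset (Fin n)) : Prop :=
  B.card = Module.finrank ℂ V ∧ rankOn B V = B.card

theorem IsRowBasis.card_inter_le {n : ℕ} {V : Submodule ℂ (Fin n → ℂ)} {B : Finset (Fin n)}
    (hB : IsRowBasis V B) (S : Finset (Fin n)) : (B ∩ S).card ≤ rankOn S V := by
  rw [← rankOn_eq_card_of_subset Finset.inter_subset_left hB.2]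
  exact rankOn_mono_left Finset.inter_subset_right V

/-- Every independent set of rows is contained in a basis. -/
theorem exists_isRowBasis_superset {n : ℕ} {V : Submodule ℂ (Fin n → ℂ)} {I : Finset (Fin n)}
    (hI : rankOn I V = I.card) : ∃ B, I ⊆ B ∧ IsRowBasis V B := by
  obtain ⟨J, hIJ, -, hJ, hc⟩ := exists_indep_extension V (Finset.subset_univ I) hI
  exact ⟨J, hIJ, hc.trans (rankOn_univ V), hJ⟩

/-- The rank of `S` is the largest size of `B ∩ S` over all bases `B`. -/
theorem exists_isRowBasis_card_inter {n : ℕ} (V : Submodule ℂ (Fin n → ℂ))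
    (S : Finset (Fin n)) : ∃ B, IsRowBasis V B ∧ (B ∩ S).card = rankOn S V := by
  have h0 : rankOn (∅ : Finset (Fin n)) V = (∅ : Finset (Fin n)).card :=
    le_antisymm (rankOn_le_card _ _) (Nat.zero_le _)
  obtain ⟨I, -, hIS, hI, hc⟩ := exists_indep_extension V (Finset.empty_subset S) h0
  obtain ⟨B, hIB, hB⟩ := exists_isRowBasis_superset hI
  refine ⟨B, hB, le_antisymm (hB.card_inter_le S) ?_⟩
  rw [← hc]
  exact Finset.card_le_card (Finset.subset_inter hIB hIS)

theorem IsRowBasis.exists_superset {n : ℕ} {V W : Submodule ℂ (Fin n → ℂ)}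
    {B : Finset (Fin n)} (h : V ≤ W) (hB : IsRowBasis V B) : ∃ C, B ⊆ C ∧ IsRowBasis W C :=
  exists_isRowBasis_superset (le_antisymm (rankOn_le_card _ _)
    (hB.2.symm.le.trans (rankOn_mono_right B h)))

theorem IsRowBasis.exists_subset {n : ℕ} {V W : Submodule ℂ (Fin n → ℂ)}
    {B : Finset (Fin n)} (h : V ≤ W) (hB : IsRowBasis W B) : ∃ C, C ⊆ B ∧ IsRowBasis V C := by
  have h0 : rankOn (∅ : Finset (Fin n)) V = (∅ : Finset (Fin n)).card :=
    le_antisymm (rankOn_le_card _ _) (Nat.zero_le _)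
  obtain ⟨C, -, hCB, hC, hc⟩ := exists_indep_extension V (Finset.empty_subset B) h0
  exact ⟨C, hCB, hc.trans (rankOn_eq_finrank_of_le h (hB.2.trans hB.1)), hC⟩

/-- If `V ≤ W`, `B` is a basis of `V` and no row in `S` enlarges `B` to a set independent on `W`,
then `V` and `W` have the same image in the coordinates `S ∪ B`, so the same rank on `S`. -/
theorem IsRowBasis.rankOn_le_of_forall {n : ℕ} {V W : Submodule ℂ (Fin n → ℂ)}
    {B S : Finset (Fin n)} (h : V ≤ W) (hB : IsRowBasis V B)
    (hS : ∀ y ∈ S, y ∉ B → rankOn (insert y B) W ≠ (insert y B).card) :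
    rankOn S W ≤ rankOn S V := by
  have hBW : rankOn B W = B.card := le_antisymm (rankOn_le_card _ _)
    (hB.2.symm.le.trans (rankOn_mono_right B h))
  obtain ⟨J, hBJ, hJ, hJW, hc⟩ := exists_indep_extension W
    (Finset.subset_union_right : B ⊆ S ∪ B) hBW
  have hJB : J = B := by
    refine (Finset.Subset.antisymm hBJ fun y hy => ?_).symm
    by_contra hyB
    have hyS : y ∈ S := (Finset.mem_union.1 (hJ hy)).resolve_right hyB
    exact hS y hyS hyB (rankOn_eq_card_of_subset (Finset.insert_subset hy hBJ) hJW)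
  have hmap : V.map (LinearMap.funLeft ℂ ℂ (Subtype.val : (S ∪ B : Finset (Fin n)) → Fin n)) =
      W.map (LinearMap.funLeft ℂ ℂ (Subtype.val : (S ∪ B : Finset (Fin n)) → Fin n)) := by
    refine Submodule.eq_of_le_of_finrank_le (Submodule.map_mono h) ?_
    have h1 := rankOn_mono_left (Finset.subset_union_right : B ⊆ S ∪ B) V
    rw [hB.2, ← congrArg Finset.card hJB, hc] at h1
    exact h1
  have hcomp : LinearMap.funLeft ℂ ℂ (Subtype.val : S → Fin n) =
      (LinearMap.funLeft ℂ ℂ (fun x : S => (⟨x, Finset.mem_union_left B x.2⟩ :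
        (S ∪ B : Finset (Fin n))))) ∘ₗ
      LinearMap.funLeft ℂ ℂ (Subtype.val : (S ∪ B : Finset (Fin n)) → Fin n) := rfl
  rw [rankOn, rankOn, hcomp, Submodule.map_comp, Submodule.map_comp, hmap]

/-- If, for all `m`, the rows `x` with `f x < m` have as rank the number of those among them that
lie in `A`, then the latter are independent: they are the rows picked by the greedy algorithm in
the order of increasing `f`. -/
theorem rankOn_eq_card_of_greedy {n : ℕ} {V : Submodule ℂ (Fin n → ℂ)} {A : Finset (Fin n)}
    {f : Fin n → ℕ} (hf : Function.Injective f)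
    (h : ∀ m, rankOn (Finset.univ.filter fun x => f x < m) V =
      (A ∩ Finset.univ.filter fun x => f x < m).card) (m : ℕ) :
    rankOn (A ∩ Finset.univ.filter fun x => f x < m) V =
      (A ∩ Finset.univ.filter fun x => f x < m).card := by
  induction m with
  | zero => simpa using h 0
  | succ m ih =>
    have hsub : Finset.univ.filter (fun x => f x < m) ⊆ Finset.univ.filter (fun x => f x < m + 1) := by
      intro x hx
      simp only [Finset.mem_filter, Finset.mem_univ, true_and] at hx ⊢
      omega
    obtain ⟨J, hIJ, hJT, hJ, hc⟩ := exists_indep_extension V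
      ((Finset.inter_subset_right (s₁ := A)).trans hsub) ih
    rw [h] at hc
    suffices hsup : A ∩ Finset.univ.filter (fun x => f x < m + 1) ⊆ J by
      rwa [Finset.eq_of_subset_of_card_le hsup hc.le]
    intro x hx
    by_contra hxJ
    -- The only row `y` with `f y < m + 1` but not `f y < m` is `x`, so `J` has no such row.
    have hJm : J ⊆ Finset.univ.filter (fun x => f x < m) := by
      intro y hy
      have hy' := hJT hy
      have hxf := (Finset.mem_inter.1 hx).2
      have hxm : x ∉ A ∩ Finset.univ.filter (fun x => f x < m) := fun hh => hxJ (hIJ hh)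
      simp only [Finset.mem_inter, Finset.mem_filter, Finset.mem_univ, true_and, not_and] at *
      have hne : f y ≠ f x := fun hh => hxJ (hf hh ▸ hy)
      have := hxm hx.1
      omega
    have h1 := rankOn_mono_left hJm V
    have h2 : (A ∩ Finset.univ.filter (fun x => f x < m)).card <
        (A ∩ Finset.univ.filter (fun x => f x < m + 1)).card := by
      refine Finset.card_lt_card ((Finset.ssubset_iff_of_subset
        (Finset.inter_subset_inter_left hsub)).2 ⟨x, hx, fun hh => hxJ (hIJ hh)⟩)
    rw [h, hJ] at h1
    omega

/-! ### Plücker coordinates and bases -/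

theorem plucker_ne_zero_iff {n : ℕ} (F : CompleteFlag n) (ρ : Fin n → Fin n) (k : Fin n)
    (hρ : Set.InjOn ρ (Set.Iic k)) :
    plucker F ρ k ≠ 0 ↔ IsRowBasis (F.space k) ((Finset.Iic k).image ρ) := by
  have hcard : ((Finset.Iic k).image ρ).card = (k : ℕ) + 1 := by
    rw [Finset.card_image_of_injOn (by simpa using hρ), Fin.card_Iic]
  let ι : Fin ((k : ℕ) + 1) → Fin n := fun i => ρ (Fin.castLE k.isLt i)
  have hι : Function.Injective ι := fun i j hij => by
    have := hρ (Nat.le_of_lt_succ i.isLt : Fin.castLE k.isLt i ≤ k)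
      (Nat.le_of_lt_succ j.isLt : Fin.castLE k.isLt j ≤ k) hij
    exact Fin.castLE_injective _ this
  have hmem : ∀ i, ι i ∈ (Finset.Iic k).image ρ := fun i =>
    Finset.mem_image_of_mem ρ (Finset.mem_Iic.2 (Nat.le_of_lt_succ i.isLt))
  let e : Fin ((k : ℕ) + 1) ≃ ((Finset.Iic k).image ρ : Finset (Fin n)) :=
    Equiv.ofBijective (fun i => ⟨ι i, hmem i⟩) ((Fintype.bijective_iff_injective_and_card _).2
      ⟨fun i j hij => hι (congrArg Subtype.val hij), by rw [Fintype.card_coe, hcard, Fintype.card_fin]⟩)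
  have hmap : (F.space k).map (LinearMap.funLeft ℂ ℂ ι) =
      ((F.space k).map (LinearMap.funLeft ℂ ℂ
        (Subtype.val : ((Finset.Iic k).image ρ : Finset (Fin n)) → Fin n))).map
        (LinearEquiv.funCongrLeft ℂ ℂ e).toLinearMap := by
    rw [← Submodule.map_comp]
    rfl
  rw [plucker, F.isRep_rep.leadingMinor_ne_zero_iff ρ k]
  change (F.space k).map (LinearMap.funLeft ℂ ℂ ι) = ⊤ ↔ _
  have hrank : Module.finrank ℂ ((F.space k).map (LinearMap.funLeft ℂ ℂ ι)) =
      rankOn ((Finset.Iic k).image ρ) (F.space k) := by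
    rw [hmap, LinearEquiv.finrank_map_eq]
    rfl
  rw [IsRowBasis, hcard, F.finrank_space, ← hrank]
  constructor
  · intro h
    rw [h, finrank_top]
    simp
  · rintro ⟨-, h⟩
    exact Submodule.eq_top_of_finrank_eq (by simpa using h)

theorem plucker_perm_ne_zero_iff {n : ℕ} (F : CompleteFlag n) (w : Equiv.Perm (Fin n))
    (k : Fin n) : plucker F w k ≠ 0 ↔ IsRowBasis (F.space k) (prefixSet w k) :=
  plucker_ne_zero_iff F w k w.injective.injOn

theorem multiPlucker_ne_zero_iff {n : ℕ} (F : CompleteFlag n) (w : Equiv.Perm (Fin n)) :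
    multiPlucker F w ≠ 0 ↔ ∀ k, IsRowBasis (F.space k) (prefixSet w k) := by
  simp only [multiPlucker, Finset.prod_ne_zero_iff, Finset.mem_univ, true_imp_iff,
    plucker_perm_ne_zero_iff]

/-- The coordinate `Δ_{w[k-1] ∪ {w_i}}` for `k < i`. -/
theorem plucker_update_ne_zero_iff {n : ℕ} (F : CompleteFlag n) (w : Equiv.Perm (Fin n))
    {i k : Fin n} (hik : k < i) : plucker F (Function.update w k (w i)) k ≠ 0 ↔
      IsRowBasis (F.space k) (insert (w i) ((Finset.Iio k).image w)) := by
  have hne : ∀ j < k, Function.update w k (w i) j = w j := fun j hj =>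
    Function.update_of_ne hj.ne _ _
  rw [plucker_ne_zero_iff]
  · rw [← Finset.Iio_insert k, Finset.image_insert, Function.update_self,
      Finset.image_congr (g := w) fun j hj => hne j (by simpa using hj)]
  · intro p hp q hq hpq
    rcases (Set.mem_Iic.1 hp).eq_or_lt with rfl | hp' <;>
      rcases (Set.mem_Iic.1 hq).eq_or_lt with rfl | hq'
    · rfl
    · rw [Function.update_self, hne q hq'] at hpq
      exact absurd (w.injective hpq) (hq'.trans hik).ne'
    · rw [Function.update_self, hne p hp'] at hpq
      exact absurd (w.injective hpq) (hp'.trans hik).ne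
    · rw [hne p hp', hne q hq'] at hpq
      exact w.injective hpq

/-! ### Cyclic segments and the shifted Gale order -/

theorem mem_cyclicIco {n : ℕ} {r i x : Fin n} : x ∈ cyclicIco r i ↔ x - r < i - r := by
  have hr := r.isLt
  have hi := i.isLt
  have hx := x.isLt
  unfold cyclicIco
  rw [Fin.lt_def, Fin.sub_def, Fin.sub_def]
  have h1 : (n - (r : ℕ) + x) % n = if (r : ℕ) ≤ x then (x : ℕ) - r else n - r + x := by
    split_ifs
    · rw [show n - (r : ℕ) + x = (x - r) + n by omega, Nat.add_mod_right,
        Nat.mod_eq_of_lt (by omega)]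
    · rw [Nat.mod_eq_of_lt (by omega)]
  have h2 : (n - (r : ℕ) + i) % n = if (r : ℕ) ≤ i then (i : ℕ) - r else n - r + i := by
    split_ifs
    · rw [show n - (r : ℕ) + i = (i - r) + n by omega, Nat.add_mod_right,
        Nat.mod_eq_of_lt (by omega)]
    · rw [Nat.mod_eq_of_lt (by omega)]
  simp only [h1, h2, Fin.le_def]
  by_cases h : (r : ℕ) ≤ i
  · simp only [h, if_true, Finset.mem_Ico, Fin.le_def, Fin.lt_def]
    split_ifs <;> omega
  · simp only [h, if_false, Finset.mem_union, Finset.mem_Ici, Finset.mem_Iio, Fin.le_def,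
      Fin.lt_def]
    split_ifs <;> omega

/-- Away from the empty segment at `i = r`, the final segments of the order `<_r` are the
`[i, r)_c`. -/
theorem mem_cyclicIco_right {n : ℕ} {r i x : Fin n} :
    x ∈ cyclicIco i r ↔ i ≠ r ∧ i - r ≤ x - r := by
  rcases eq_or_ne i r with rfl | h
  · simp [cyclicIco]
  · have : x ∈ cyclicIco i r ↔ x ∉ cyclicIco r i := by
      have h' : (i : ℕ) ≠ r := fun hh => h (Fin.ext hh)
      unfold cyclicIco
      rcases lt_or_gt_of_ne h' with h1 | h1
      · rw [if_pos (Fin.le_def.2 h1.le), if_neg (fun hh => by rw [Fin.le_def] at hh; omega)]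
        simp only [Finset.mem_union, Finset.mem_Ico, Finset.mem_Ici, Finset.mem_Iio, Fin.le_def,
          Fin.lt_def]
        omega
      · rw [if_pos (Fin.le_def.2 h1.le), if_neg (fun hh => by rw [Fin.le_def] at hh; omega)]
        simp only [Finset.mem_union, Finset.mem_Ico, Finset.mem_Ici, Finset.mem_Iio, Fin.le_def,
          Fin.lt_def]
        omega
    rw [this, mem_cyclicIco, not_lt]
    simp [h]

theorem cyclicIco_self {n : ℕ} (r : Fin n) : cyclicIco r r = ∅ := by
  simp [cyclicIco]

/-- The two cyclic segments between distinct `r` and `i` are complementary. -/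
theorem card_inter_cyclicIco_add {n : ℕ} (A : Finset (Fin n)) {r i : Fin n} (h : i ≠ r) :
    (A ∩ cyclicIco r i).card + (A ∩ cyclicIco i r).card = A.card := by
  have : A ∩ cyclicIco i r = A \ cyclicIco r i := by
    ext x
    rw [Finset.mem_inter, Finset.mem_sdiff, mem_cyclicIco_right, mem_cyclicIco, not_lt]
    simp [h]
  rw [this, Finset.card_inter_add_card_sdiff]

theorem injective_sub_base {n : ℕ} (r : Fin n) :
    Function.Injective fun x : Fin n => x - r := by
  have : NeZero n := ⟨by have := r.isLt; omega⟩
  exact sub_left_injective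

/-- Every initial segment `{x | x - r < m}` of the order `<_r` is some `[r, i)_c` or everything. -/
theorem forall_initial_segment {n : ℕ} {P : Finset (Fin n) → Prop} {r : Fin n}
    (huniv : P Finset.univ) (h : ∀ i, P (cyclicIco r i)) (m : ℕ) :
    P (Finset.univ.filter fun x => ((x - r : Fin n) : ℕ) < m) := by
  have : NeZero n := ⟨by have := r.isLt; omega⟩
  by_cases hm : m < n
  · have : (Finset.univ.filter fun x => ((x - r : Fin n) : ℕ) < m) =
        cyclicIco r ((⟨m, hm⟩ : Fin n) + r) := by
      ext x
      rw [mem_cyclicIco, add_sub_cancel_right, Finset.mem_filter, Fin.lt_def]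
      simp
    rw [this]
    exact h _
  · have : (Finset.univ.filter fun x => ((x - r : Fin n) : ℕ) < m) = Finset.univ :=
      Finset.filter_true_of_mem fun x _ => by have := (x - r).isLt; omega
    rwa [this]

/-- Every final segment `{x | m ≤ x - r}` of the order `<_r` is some `[i, r)_c` or everything. -/
theorem forall_final_segment {n : ℕ} {P : Finset (Fin n) → Prop} {r : Fin n}
    (huniv : P Finset.univ) (h : ∀ i, P (cyclicIco i r)) (m : ℕ) :
    P (Finset.univ.filter fun x => m ≤ ((x - r : Fin n) : ℕ)) := by
  have : NeZero n := ⟨by have := r.isLt; omega⟩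
  by_cases hm0 : m = 0
  · have : (Finset.univ.filter fun x => m ≤ ((x - r : Fin n) : ℕ)) = Finset.univ :=
      Finset.filter_true_of_mem fun x _ => by omega
    rwa [this]
  by_cases hm : m < n
  · have hne : (⟨m, hm⟩ : Fin n) + r ≠ r := by
      rw [Ne, add_eq_right, Fin.ext_iff]
      exact hm0
    have : (Finset.univ.filter fun x => m ≤ ((x - r : Fin n) : ℕ)) =
        cyclicIco ((⟨m, hm⟩ : Fin n) + r) r := by
      ext x
      rw [mem_cyclicIco_right, add_sub_cancel_right, Finset.mem_filter, Fin.le_def]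
      simp [hne]
    rw [this]
    exact h _
  · have : (Finset.univ.filter fun x => m ≤ ((x - r : Fin n) : ℕ)) = cyclicIco r r := by
      rw [cyclicIco_self]
      exact Finset.filter_false_of_mem fun x _ => by have := (x - r).isLt; omega
    rw [this]
    exact h r

/-- The shifted Gale order in terms of counts on initial segments. -/
theorem shiftedGaleLE_iff_card_inter {n : ℕ} {r : Fin n} {A B : Finset (Fin n)} :
    shiftedGaleLE r A B ↔
      A.card = B.card ∧ ∀ i, (B ∩ cyclicIco r i).card ≤ (A ∩ cyclicIco r i).card := by
  constructor
  · rintro ⟨m, α, β, hα, hβ, rfl, rfl, h⟩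
    have hαi : Function.Injective α := StrictMono.injective (f := fun i => α i - r)
      (fun i j hij => hα i j hij) |>.of_comp (f := fun x => x - r) 
    have hβi : Function.Injective β := StrictMono.injective (f := fun i => β i - r)
      (fun i j hij => hβ i j hij) |>.of_comp (f := fun x => x - r)
    refine ⟨by rw [Finset.card_image_of_injective _ hαi, Finset.card_image_of_injective _ hβi],
      fun i => ?_⟩
    have key : ∀ γ : Fin m → Fin n, Function.Injective γ →
        (Finset.univ.image γ ∩ cyclicIco r i).card =
          (Finset.univ.filter fun j => γ j ∈ cyclicIco r i).card := by
      intro γ hγ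
      rw [← Finset.card_image_of_injective _ hγ]
      congr 1
      ext x
      simp only [Finset.mem_inter, Finset.mem_image, Finset.mem_univ, true_and, Finset.mem_filter]
      constructor
      · rintro ⟨⟨j, rfl⟩, hj⟩
        exact ⟨j, hj, rfl⟩
      · rintro ⟨j, hj, rfl⟩
        exact ⟨⟨j, rfl⟩, hj⟩
    rw [key α hαi, key β hβi]
    refine Finset.card_le_card fun j hj => ?_
    simp only [Finset.mem_filter, Finset.mem_univ, true_and, mem_cyclicIco] at hj ⊢
    exact (h j).trans_lt hj
  · rintro ⟨hcard, h⟩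
    have : NeZero n := ⟨by have := r.isLt; omega⟩
    have hA : (A.image fun x => x - r).card = A.card :=
      Finset.card_image_of_injective _ (injective_sub_base r)
    have hB : (B.image fun x => x - r).card = A.card :=
      (Finset.card_image_of_injective _ (injective_sub_base r)).trans hcard.symm
    set α := (A.image fun x => x - r).orderEmbOfFin hA with hα
    set β := (B.image fun x => x - r).orderEmbOfFin hB with hβ
    have himg : ∀ C : Finset (Fin n), ∀ hC : (C.image fun x => x - r).card = A.card,
        Finset.univ.image (fun i => (C.image fun x => x - r).orderEmbOfFin hC i + r) = C := by
      intro C hC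
      have := Finset.image_orderEmbOfFin_univ (C.image fun x => x - r) hC
      rw [show (fun i => (C.image fun x => x - r).orderEmbOfFin hC i + r) =
        (fun x => x + r) ∘ (C.image fun x => x - r).orderEmbOfFin hC from rfl,
        ← Finset.image_image, this, Finset.image_image]
      simp [Function.comp_def]
    refine ⟨A.card, fun i => α i + r, fun i => β i + r, ?_, ?_, himg A hA, himg B hB, ?_⟩
    · intro i j hij
      simpa [shiftedLT] using hij
    · intro i j hij
      simpa [shiftedLT] using hij
    · intro i
      simp only [shiftedLE, add_sub_cancel_right]
      by_contra hlt
      rw [not_le] at hlt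
      -- The segment below `α i` contains only `i` elements of `A`, but `i + 1` elements of `B`.
      have hi := h (α i + r)
      have h1 : (Finset.Iic i).image (fun j => β j + r) ⊆ B ∩ cyclicIco r (α i + r) := by
        intro x hx
        obtain ⟨j, hj, rfl⟩ := Finset.mem_image.1 hx
        refine Finset.mem_inter.2 ⟨?_, ?_⟩
        · exact (himg B hB).subset (Finset.mem_image_of_mem _ (Finset.mem_univ j))
        · rw [mem_cyclicIco, add_sub_cancel_right, add_sub_cancel_right]
          exact (β.monotone (Finset.mem_Iic.1 hj)).trans_lt hlt
      have h2 : A ∩ cyclicIco r (α i + r) ⊆ (Finset.Iio i).image (fun j => α j + r) := by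
        intro x hx
        obtain ⟨hxA, hxc⟩ := Finset.mem_inter.1 hx
        rw [← himg A hA] at hxA
        obtain ⟨j, -, rfl⟩ := Finset.mem_image.1 hxA
        rw [mem_cyclicIco, add_sub_cancel_right, add_sub_cancel_right] at hxc
        exact Finset.mem_image_of_mem _ (Finset.mem_Iio.2 (α.lt_iff_lt.1 hxc))
      have h3 := Finset.card_le_card h1
      have h4 := (Finset.card_le_card h2).trans Finset.card_image_le
      rw [Finset.card_image_of_injective _ (fun a b hab => β.injective (add_left_injective r hab)),
        Fin.card_Iic] at h3
      rw [Fin.card_Iio] at h4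
      omega

/-! ### Lattice paths and degrees -/

/-- The number of elements of `A` below `x`. -/
def belowCount {n : ℕ} (A : Finset (Fin n)) (x : ℕ) : ℕ :=
  (A.filter fun a : Fin n => (a : ℕ) < x).card

/-- The height at `x` of the lattice path comparing `A` and `B`, which goes up at the elements of
`B \ A` and down at those of `A \ B`. -/
def gap {n : ℕ} (A B : Finset (Fin n)) (x : ℕ) : ℤ :=
  (belowCount B x : ℤ) - belowCount A x

/-- The maximal height of the lattice path comparing `A` and `B`. The truncated subtraction does no
harm since the path starts at height `0`. -/
def degree {n : ℕ} (A B : Finset (Fin n)) : ℕ :=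
  (Finset.range n).sup fun x => belowCount B x - belowCount A x

theorem belowCount_zero {n : ℕ} (A : Finset (Fin n)) : belowCount A 0 = 0 := by
  simp [belowCount]

theorem belowCount_of_ge {n : ℕ} (A : Finset (Fin n)) {x : ℕ} (hx : n ≤ x) :
    belowCount A x = A.card := by
  rw [belowCount, Finset.filter_true_of_mem]
  intro a _
  have := a.isLt
  omega

theorem gap_add {n : ℕ} (A B C : Finset (Fin n)) (x : ℕ) :
    gap A B x + gap B C x = gap A C x := by
  unfold gap
  omega

theorem gap_le_degree {n : ℕ} {A B : Finset (Fin n)} (h : A.card = B.card) (x : ℕ) :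
    gap A B x ≤ degree A B := by
  by_cases hx : x < n
  · have := Finset.le_sup (f := fun x => belowCount B x - belowCount A x) (Finset.mem_range.2 hx)
    unfold gap degree
    omega
  · rw [gap, belowCount_of_ge A (not_lt.1 hx), belowCount_of_ge B (not_lt.1 hx)]
    omega

theorem degree_le_iff {n : ℕ} {A B : Finset (Fin n)} {d : ℕ} :
    degree A B ≤ d ↔ ∀ x < n, belowCount B x ≤ belowCount A x + d := by
  simp only [degree, Finset.sup_le_iff, Finset.mem_range, tsub_le_iff_left]

theorem degree_self {n : ℕ} (A : Finset (Fin n)) : degree A A = 0 := by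
  rw [← Nat.le_zero, degree_le_iff]
  simp

theorem degree_triangle {n : ℕ} (A B C : Finset (Fin n)) :
    degree A C ≤ degree A B + degree B C := by
  rw [degree_le_iff]
  intro x hx
  have h1 := degree_le_iff.1 (le_refl (degree A B)) x hx
  have h2 := degree_le_iff.1 (le_refl (degree B C)) x hx
  omega

theorem exists_gap_eq_degree {n : ℕ} (hn : 0 < n) (A B : Finset (Fin n)) :
    ∃ r : Fin n, gap A B r = degree A B := by
  obtain ⟨x, hx, h⟩ := Finset.exists_mem_eq_sup (Finset.range n) ⟨0, Finset.mem_range.2 hn⟩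
    (fun x => belowCount B x - belowCount A x)
  have hdef : degree A B = belowCount B x - belowCount A x := h
  by_cases hle : belowCount A x ≤ belowCount B x
  · refine ⟨⟨x, Finset.mem_range.1 hx⟩, ?_⟩
    rw [gap, hdef]
    simp only
    omega
  · refine ⟨⟨0, hn⟩, ?_⟩
    rw [gap, hdef, belowCount_zero, belowCount_zero]
    omega

theorem card_inter_cyclicIco {n : ℕ} (A : Finset (Fin n)) (r i : Fin n) :
    (A ∩ cyclicIco r i).card + belowCount A r =
      belowCount A i + if i < r then A.card else 0 := by
  have h1 : A ∩ cyclicIco r i = A.filter (· ∈ cyclicIco r i) := by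
    ext x
    simp
  have h2 : (if i < r then A.card else 0) = ∑ x ∈ A, if i < r then 1 else 0 := by
    split_ifs <;> simp
  rw [h1, h2, belowCount, belowCount, Finset.card_filter, Finset.card_filter, Finset.card_filter,
    ← Finset.sum_add_distrib, ← Finset.sum_add_distrib]
  refine Finset.sum_congr rfl fun x _ => ?_
  unfold cyclicIco
  simp only [Fin.le_def, Fin.lt_def]
  by_cases h : (r : ℕ) ≤ i
  · simp only [h, if_true, Finset.mem_Ico, Fin.le_def, Fin.lt_def]
    split_ifs <;> omega
  · simp only [h, if_false, Finset.mem_union, Finset.mem_Ici, Finset.mem_Iio, Fin.le_def,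
      Fin.lt_def]
    split_ifs <;> omega

/-- The shifted orders `≤_r` relating `A` and `B` are those for which the lattice path is highest
at `r`. -/
theorem shiftedGaleLE_iff {n : ℕ} {r : Fin n} {A B : Finset (Fin n)} :
    shiftedGaleLE r A B ↔ A.card = B.card ∧ gap A B r = degree A B := by
  rw [shiftedGaleLE_iff_card_inter]
  refine and_congr_right fun hAB => ?_
  have hseg : ∀ i : Fin n, (B ∩ cyclicIco r i).card ≤ (A ∩ cyclicIco r i).card ↔
      gap A B i ≤ gap A B r := by
    intro i
    have h1 := card_inter_cyclicIco A r i
    have h2 := card_inter_cyclicIco B r i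
    unfold gap
    rw [hAB] at h1
    omega
  simp only [hseg]
  constructor
  · intro h
    refine le_antisymm (gap_le_degree hAB _) ?_
    obtain ⟨s, hs⟩ := exists_gap_eq_degree (by have := r.isLt; omega) A B
    rw [← hs]
    exact h s
  · intro h i
    rw [h]
    exact gap_le_degree hAB _

/-- For `A ≤_r B`, the sets between `A` and `B` are those at which the degree is additive; this
condition does not involve `r`. -/
theorem degree_add_iff {n : ℕ} {r : Fin n} {A B C : Finset (Fin n)} (h : shiftedGaleLE r A C)
    (hB : B.card = A.card) :
    degree A B + degree B C = degree A C ↔ shiftedGaleLE r A B ∧ shiftedGaleLE r B C := by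
  obtain ⟨hAC, hr⟩ := shiftedGaleLE_iff.1 h
  have h1 := gap_le_degree hB.symm (r : ℕ)
  have h2 := gap_le_degree (hB.trans hAC) (r : ℕ)
  have h3 := gap_add A B C r
  rw [shiftedGaleLE_iff, shiftedGaleLE_iff]
  constructor
  · intro hd
    exact ⟨⟨hB.symm, by omega⟩, ⟨hB.trans hAC, by omega⟩⟩
  · rintro ⟨⟨-, h4⟩, -, h5⟩
    omega

/-- If `[r, s)_c` contains equally many elements of `A` and `B`, the lattice path has the same
height at `r` and `s`. -/
theorem shiftedGaleLE_of_card_inter_eq {n : ℕ} {r s : Fin n} {A B : Finset (Fin n)}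
    (h : shiftedGaleLE r A B) (hs : (A ∩ cyclicIco r s).card = (B ∩ cyclicIco r s).card) :
    shiftedGaleLE s A B := by
  rw [shiftedGaleLE_iff] at h ⊢
  refine ⟨h.1, ?_⟩
  rw [← h.2]
  have h1 := card_inter_cyclicIco A r s
  have h2 := card_inter_cyclicIco B r s
  rw [h.1] at h1
  unfold gap
  omega

/-! ### Lengths of permutations -/

/-- Exchanging increasing entries `w i < w j` adds one inversion, and two more for each entry
between them in both position and value. -/
theorem permLength_mul_swap_of_lt {n : ℕ} (i : Fin n) (d : ℕ) : ∀ (w : Equiv.Perm (Fin n))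
    (j : Fin n), (j : ℕ) = (i : ℕ) + d + 1 → w i < w j →
    permLength (w * Equiv.swap i j) = permLength w + 1 +
      2 * (Finset.univ.filter fun k => i < k ∧ k < j ∧ w i < w k ∧ w k < w j).card := by
  induction d with
  | zero =>
    intro w j hj h
    rw [permLength_mul_swap w i j (by omega) h]
    have : (Finset.univ.filter fun k => i < k ∧ k < j ∧ w i < w k ∧ w k < w j) = ∅ := by
      refine Finset.filter_eq_empty_iff.2 fun k _ hk => ?_
      simp only [Fin.lt_def] at hk
      omega
    rw [this]
    rfl
  | succ d ih =>
    intro w j hj h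
    -- Conjugate by the adjacent transposition of `j - 1` and `j`.
    obtain ⟨p, hp⟩ : ∃ p : Fin n, (p : ℕ) = (i : ℕ) + d + 1 := ⟨⟨i + d + 1, by omega⟩, rfl⟩
    have hij : i ≠ j := fun hh => by subst hh; omega
    have hip : i ≠ p := fun hh => by subst hh; omega
    have hpj : p ≠ j := fun hh => by subst hh; omega
    set x := w * Equiv.swap p j with hx
    have hxi : x i = w i := by simp [hx, Equiv.swap_apply_of_ne_of_ne hip hij]
    have hxp : x p = w j := by simp [hx]
    have hxj : x j = w p := by simp [hx]
    have hxo : ∀ k, k ≠ p → k ≠ j → x k = w k := fun k h1 h2 => by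
      simp [hx, Equiv.swap_apply_of_ne_of_ne h1 h2]
    have hih := ih x p hp (by rw [hxi, hxp]; exact h)
    set y := x * Equiv.swap i p with hy
    have hyi : y p = w i := by simp [hy, hxi]
    have hyj : y j = w p := by simp [hy, Equiv.swap_apply_of_ne_of_ne hij.symm hpj.symm, hxj]
    have hconj : w * Equiv.swap i j = y * Equiv.swap p j := by
      rw [hy, hx, mul_assoc, mul_assoc, Equiv.swap_comm i j,
        ← Equiv.swap_mul_swap_mul_swap hip hij, mul_assoc]
    have hxx : x * Equiv.swap p j = w := by
      rw [hx, mul_assoc, Equiv.swap_mul_self, mul_one]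
    have hset : (Finset.univ.filter fun k => i < k ∧ k < j ∧ w i < w k ∧ w k < w j) =
        (Finset.univ.filter fun k => i < k ∧ k < p ∧ x i < x k ∧ x k < x p) ∪
          (if w i < w p ∧ w p < w j then {p} else ∅) := by
      ext k
      rw [Finset.mem_union, Finset.mem_filter, Finset.mem_filter]
      by_cases hkp : k = p
      · subst hkp
        have h1 : i < k ∧ k < j := by constructor <;> rw [Fin.lt_def] <;> omega
        split_ifs with h2 <;> simp [h1, h2]
      · have h1 : k < j ↔ k < p := by
          have : (k : ℕ) ≠ p := fun hh => hkp (Fin.ext hh)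
          rw [Fin.lt_def, Fin.lt_def]
          omega
        rw [h1, hxi, hxp]
        by_cases h3 : k < p
        · have h4 : k ≠ j := (h1.2 h3).ne
          rw [hxo k hkp h4]
          split_ifs <;> simp [hkp]
        · split_ifs <;> simp [hkp, h3]
    have hdisj : Disjoint (Finset.univ.filter fun k => i < k ∧ k < p ∧ x i < x k ∧ x k < x p)
        (if w i < w p ∧ w p < w j then {p} else ∅) := by
      split_ifs <;> simp
    rw [hset, Finset.card_union_of_disjoint hdisj, hconj]
    have hadj : (j : ℕ) = (p : ℕ) + 1 := by omega
    have hwip : w i ≠ w p := fun hh => hip (w.injective hh)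
    have hwpj : w p ≠ w j := fun hh => hpj (w.injective hh)
    rcases lt_or_gt_of_ne hwpj with h1 | h1
    · have e1 := permLength_mul_swap w p j hadj h1
      rw [← hx] at e1
      rcases lt_or_gt_of_ne hwip with h2 | h2
      · have e2 := permLength_mul_swap y p j hadj (by rw [hyi, hyj]; exact h2)
        rw [if_pos ⟨h2, h1⟩, Finset.card_singleton]
        omega
      · have e2 := permLength_mul_swap (y * Equiv.swap p j) p j hadj (by simp [hyi, hyj, h2])
        rw [mul_assoc, Equiv.swap_mul_self, mul_one] at e2
        rw [if_neg (fun hh => lt_asymm h2 hh.1), Finset.card_empty]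
        omega
    · have e1 := permLength_mul_swap x p j hadj (by rw [hxp, hxj]; exact h1)
      rw [hxx] at e1
      have e2 := permLength_mul_swap y p j hadj (by rw [hyi, hyj]; exact h.trans h1)
      rw [if_neg (fun hh => lt_asymm h1 hh.2), Finset.card_empty]
      omega

/-- An entry exchange whose length change is `+1` moves the larger entry to the left. -/
theorem lt_of_permLength_mul_swap {n : ℕ} {w : Equiv.Perm (Fin n)} {i j : Fin n} (hij : i < j)
    (h : permLength (w * Equiv.swap i j) = permLength w + 1) : w i < w j := by
  by_contra hlt
  have hlt' : w j < w i :=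
    lt_of_le_of_ne (not_lt.1 hlt) fun hh => hij.ne' (w.injective hh)
  have hij' := Fin.lt_def.1 hij
  have := permLength_mul_swap_of_lt i ((j : ℕ) - i - 1) (w * Equiv.swap i j) j (by omega)
    (by simpa using hlt')
  rw [mul_assoc, Equiv.swap_mul_self, mul_one] at this
  omega

/-- The length change along the edges of the Bruhat order: here no entry at a position between `i`
and `j` has its value between `w i` and `w j`. -/
theorem permLength_mul_swap_of_cover {n : ℕ} {w : Equiv.Perm (Fin n)} {i j : Fin n} (hij : i < j)
    (h : w i < w j) (hk : ∀ k, i < k → k < j → ¬ (w i < w k ∧ w k < w j)) :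
    permLength (w * Equiv.swap i j) = permLength w + 1 := by
  have hij' := Fin.lt_def.1 hij
  rw [permLength_mul_swap_of_lt i ((j : ℕ) - i - 1) w j (by omega) h]
  have : (Finset.univ.filter fun k => i < k ∧ k < j ∧ w i < w k ∧ w k < w j) = ∅ :=
    Finset.filter_eq_empty_iff.2 fun k _ hh => hk k hh.1 hh.2.1 hh.2.2
  rw [this]
  rfl

/-- The length change along the quantum edges: here every entry at a position between `i` and `j`
has its value between `w j` and `w i`. -/
theorem permLength_mul_swap_of_quantum {n : ℕ} {w : Equiv.Perm (Fin n)} {i j : Fin n} (hij : i < j)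
    (h : w j < w i) (hk : ∀ k, i < k → k < j → w j < w k ∧ w k < w i) :
    permLength (w * Equiv.swap i j) + 2 * ((j : ℕ) - (i : ℕ)) = permLength w + 1 := by
  have hij' := Fin.lt_def.1 hij
  have := permLength_mul_swap_of_lt i ((j : ℕ) - i - 1) (w * Equiv.swap i j) j (by omega)
    (by simpa using h)
  rw [mul_assoc, Equiv.swap_mul_self, mul_one] at this
  have hset : (Finset.univ.filter fun k => i < k ∧ k < j ∧
      (w * Equiv.swap i j) i < (w * Equiv.swap i j) k ∧
      (w * Equiv.swap i j) k < (w * Equiv.swap i j) j) = Finset.Ioo i j := by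
    ext k
    simp only [Finset.mem_filter, Finset.mem_univ, true_and, Finset.mem_Ioo,
      Equiv.Perm.mul_apply, Equiv.swap_apply_left, Equiv.swap_apply_right]
    constructor
    · exact fun hh => ⟨hh.1, hh.2.1⟩
    · rintro ⟨h1, h2⟩
      rw [Equiv.swap_apply_of_ne_of_ne h1.ne' h2.ne]
      exact ⟨h1, h2, hk k h1 h2⟩
  rw [hset, Fin.card_Ioo] at this
  omega

/-! ### Distances in the quantum Bruhat graph -/

theorem card_prefixSet {n : ℕ} (w : Equiv.Perm (Fin n)) (k : Fin n) :
    (prefixSet w k).card = (k : ℕ) + 1 := by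
  rw [prefixSet, Finset.card_image_of_injective _ w.injective, Fin.card_Iic]

theorem apply_mem_prefixSet {n : ℕ} {w : Equiv.Perm (Fin n)} {p k : Fin n} :
    w p ∈ prefixSet w k ↔ p ≤ k := by
  simp [prefixSet]

theorem prefixSet_mul_swap_of_not_mem {n : ℕ} (w : Equiv.Perm (Fin n)) {i j k : Fin n}
    (hij : i < j) (hk : ¬ (i ≤ k ∧ k < j)) : prefixSet (w * Equiv.swap i j) k = prefixSet w k := by
  refine Finset.eq_of_subset_of_card_le (fun z hz => ?_) (by rw [card_prefixSet, card_prefixSet])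
  obtain ⟨p, hp, rfl⟩ := Finset.mem_image.1 hz
  rw [Equiv.Perm.mul_apply, apply_mem_prefixSet]
  simp only [Finset.mem_Iic, Fin.le_def, Fin.lt_def, Equiv.swap_apply_def] at *
  split_ifs with h1 h2
  · subst h1; omega
  · subst h2; omega
  · exact hp

theorem prefixSet_mul_swap_of_mem {n : ℕ} (w : Equiv.Perm (Fin n)) {i j k : Fin n}
    (hik : i ≤ k) (hkj : k < j) :
    prefixSet (w * Equiv.swap i j) k = insert (w j) ((prefixSet w k).erase (w i)) := by
  have hj : w j ∉ prefixSet w k := fun h => (apply_mem_prefixSet.1 h).not_gt hkj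
  refine (Finset.eq_of_subset_of_card_le (fun z hz => ?_) ?_)
  · obtain ⟨p, hp, rfl⟩ := Finset.mem_image.1 hz
    rw [Equiv.Perm.mul_apply, Finset.mem_insert, Finset.mem_erase, apply_mem_prefixSet]
    have hp' := Finset.mem_Iic.1 hp
    by_cases h1 : p = i
    · simp [h1]
    · have h2 : p ≠ j := (hp'.trans_lt hkj).ne
      rw [Equiv.swap_apply_of_ne_of_ne h1 h2]
      exact Or.inr ⟨fun h => h1 (w.injective h), hp'⟩
  · rw [Finset.card_insert_of_notMem fun h => hj (Finset.mem_of_mem_erase h),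
      Finset.card_erase_of_mem (apply_mem_prefixSet.2 hik), card_prefixSet, card_prefixSet]
    omega

theorem belowCount_prefixSet_mul_swap {n : ℕ} (w : Equiv.Perm (Fin n)) {i j k : Fin n}
    (hik : i ≤ k) (hkj : k < j) (x : ℕ) :
    belowCount (prefixSet (w * Equiv.swap i j) k) x + (if (w i : ℕ) < x then 1 else 0) =
      belowCount (prefixSet w k) x + if (w j : ℕ) < x then 1 else 0 := by
  have hj : w j ∉ (prefixSet w k).erase (w i) := fun h =>
    (apply_mem_prefixSet.1 (Finset.mem_of_mem_erase h)).not_gt hkj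
  have hi : w i ∈ prefixSet w k := apply_mem_prefixSet.2 hik
  rw [prefixSet_mul_swap_of_mem w hik hkj, belowCount, belowCount, Finset.card_filter,
    Finset.card_filter, Finset.sum_insert hj, ← Finset.sum_erase_add _ _ hi]
  omega

/-- The length of a path from `u` to `v` that has the minimal possible degree at each position.
An edge of the quantum Bruhat graph changes `ℓ` by `1 - 2 d`, where `d` is the number of positions
at which it has degree `1`, so a path has length `ℓ(v) - ℓ(u)` plus twice its total degree. This is
the distance in the quantum Bruhat graph, see `qbgDist_eq`. -/
def degreeDist {n : ℕ} (u v : Equiv.Perm (Fin n)) : ℤ :=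
  (permLength v : ℤ) - permLength u + 2 * ∑ k, (degree (prefixSet u k) (prefixSet v k) : ℤ)

theorem degreeDist_triangle {n : ℕ} (u v w : Equiv.Perm (Fin n)) :
    degreeDist u w ≤ degreeDist u v + degreeDist v w := by
  have : ∑ k, (degree (prefixSet u k) (prefixSet w k) : ℤ) ≤
      ∑ k, (degree (prefixSet u k) (prefixSet v k) : ℤ) +
      ∑ k, (degree (prefixSet v k) (prefixSet w k) : ℤ) := by
    rw [← Finset.sum_add_distrib]
    exact Finset.sum_le_sum fun k _ => by exact_mod_cast degree_triangle _ _ _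
  unfold degreeDist
  linarith

theorem sum_indicator_Ico {n : ℕ} (i j : Fin n) :
    ∑ k : Fin n, (if i ≤ k ∧ k < j then (1 : ℤ) else 0) = ((j : ℕ) - (i : ℕ) : ℕ) := by
  rw [Finset.sum_boole, ← Fin.card_Ico]
  congr 2
  ext k
  simp

theorem degreeDist_le_one_of_edge {n : ℕ} {u v : Equiv.Perm (Fin n)} (h : QBGEdge u v) :
    degreeDist u v ≤ 1 := by
  obtain ⟨i, j, hij, rfl, h⟩ := h
  rcases h with h | h
  · have hlt := Fin.lt_def.1 (lt_of_permLength_mul_swap hij h)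
    have h0 : ∀ k, degree (prefixSet u k) (prefixSet (u * Equiv.swap i j) k) = 0 := by
      intro k
      by_cases hk : i ≤ k ∧ k < j
      · rw [← Nat.le_zero, degree_le_iff]
        intro x _
        have := belowCount_prefixSet_mul_swap u hk.1 hk.2 x
        split_ifs at this <;> omega
      · rw [prefixSet_mul_swap_of_not_mem u hij hk, degree_self]
    simp [degreeDist, h0, h]
  · have h1 : ∀ k, (degree (prefixSet u k) (prefixSet (u * Equiv.swap i j) k) : ℤ) ≤
        if i ≤ k ∧ k < j then 1 else 0 := by
      intro k
      split_ifs with hk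
      · have : degree (prefixSet u k) (prefixSet (u * Equiv.swap i j) k) ≤ 1 := by
          rw [degree_le_iff]
          intro x _
          have := belowCount_prefixSet_mul_swap u hk.1 hk.2 x
          split_ifs at this <;> omega
        exact_mod_cast this
      · rw [prefixSet_mul_swap_of_not_mem u hij hk, degree_self]
        rfl
    have h2 := Finset.sum_le_sum fun k (_ : k ∈ Finset.univ) => h1 k
    rw [sum_indicator_Ico] at h2
    unfold degreeDist
    omega

theorem degreeDist_le_of_path {n m : ℕ} {u v : Equiv.Perm (Fin n)} (h : QBGPath m u v) :
    degreeDist u v ≤ m := by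
  induction h with
  | nil u => simp [degreeDist, degree_self]
  | @cons m u v w _ he ih =>
    have h1 := degreeDist_triangle u v w
    have h2 := degreeDist_le_one_of_edge he
    push_cast
    linarith

theorem QBGPath.prepend {n m : ℕ} {u v w : Equiv.Perm (Fin n)} (h : QBGEdge u v)
    (hp : QBGPath m v w) : QBGPath (m + 1) u w := by
  induction hp with
  | nil v => exact QBGPath.cons (QBGPath.nil u) h
  | cons _ he ih => exact QBGPath.cons (ih h) he

/-- If every element of `A` in the cyclic segment from `x` to `b` lies in `B` and `b ∈ B` is not
one of them, the lattice path of `A` and `B` rises along this segment. -/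
theorem gap_add_one_le {n : ℕ} {A B : Finset (Fin n)} (hAB : A.card = B.card) {b : Fin n}
    (hb : b ∈ B) (x : ℕ)
    (h : ∀ z ∈ A, (if x ≤ (b : ℕ) then x ≤ (z : ℕ) ∧ z ≤ b else x ≤ (z : ℕ) ∨ z ≤ b) →
      z ∈ B ∧ z ≠ b) : gap A B x + 1 ≤ gap A B ((b : ℕ) + 1) := by
  have hcount : ∀ (C : Finset (Fin n)) (y z : ℕ), y ≤ z → belowCount C z =
      belowCount C y + (C.filter fun c : Fin n => y ≤ (c : ℕ) ∧ (c : ℕ) < z).card := by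
    intro C y z hyz
    simp only [belowCount, Finset.card_filter]
    rw [← Finset.sum_add_distrib]
    refine Finset.sum_congr rfl fun c _ => ?_
    split_ifs <;> omega
  by_cases hx : x ≤ (b : ℕ)
  · have hlt : (A.filter fun c : Fin n => x ≤ (c : ℕ) ∧ (c : ℕ) < (b : ℕ) + 1).card <
        (B.filter fun c : Fin n => x ≤ (c : ℕ) ∧ (c : ℕ) < (b : ℕ) + 1).card := by
      refine Finset.card_lt_card ((Finset.ssubset_iff_of_subset ?_).2 ⟨b, ?_, ?_⟩)
      · intro z hz
        rw [Finset.mem_filter] at hz ⊢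
        exact ⟨(h z hz.1 (by rw [if_pos hx, Fin.le_def]; omega)).1, hz.2⟩
      · simp [hb, hx]
      · intro hz
        rw [Finset.mem_filter] at hz
        exact (h b hz.1 (by rw [if_pos hx, Fin.le_def]; omega)).2 rfl
    have h1 := hcount A x ((b : ℕ) + 1) (by omega)
    have h2 := hcount B x ((b : ℕ) + 1) (by omega)
    unfold gap
    omega
  · have hlt : (A.filter fun c : Fin n => ¬ ((b : ℕ) + 1 ≤ (c : ℕ) ∧ (c : ℕ) < x)).card <
        (B.filter fun c : Fin n => ¬ ((b : ℕ) + 1 ≤ (c : ℕ) ∧ (c : ℕ) < x)).card := by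
      refine Finset.card_lt_card ((Finset.ssubset_iff_of_subset ?_).2 ⟨b, ?_, ?_⟩)
      · intro z hz
        rw [Finset.mem_filter] at hz ⊢
        exact ⟨(h z hz.1 (by rw [if_neg hx, Fin.le_def]; omega)).1, hz.2⟩
      · simp [hb]
      · intro hz
        rw [Finset.mem_filter] at hz
        exact (h b hz.1 (by rw [if_neg hx, Fin.le_def]; omega)).2 rfl
    have h1 := hcount A ((b : ℕ) + 1) x (by omega)
    have h2 := hcount B ((b : ℕ) + 1) x (by omega)
    have h3 := A.card_filter_add_card_filter_not
      (fun c : Fin n => (b : ℕ) + 1 ≤ (c : ℕ) ∧ (c : ℕ) < x)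
    have h4 := B.card_filter_add_card_filter_not
      (fun c : Fin n => (b : ℕ) + 1 ≤ (c : ℕ) ∧ (c : ℕ) < x)
    unfold gap
    omega

/-- The first step of a shortest path: if `i` is the first position at which `u` and `v` differ,
exchange `u i` with the next entry of `u` in the cyclic interval from `u i` to `v i`. -/
theorem exists_edge_degreeDist {n : ℕ} {u v : Equiv.Perm (Fin n)} (huv : u ≠ v) :
    ∃ w, QBGEdge u w ∧ degreeDist w v + 1 ≤ degreeDist u v := by
  obtain ⟨i, hi, himin⟩ := (Finset.univ.filter fun i => u i ≠ v i).exists_min_image id (by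
    by_contra hne
    rw [Finset.not_nonempty_iff_eq_empty, Finset.filter_eq_empty_iff] at hne
    exact huv (Equiv.ext fun i => not_not.1 (hne (Finset.mem_univ i))))
  have hine : u i ≠ v i := (Finset.mem_filter.1 hi).2
  have hpre : ∀ p < i, u p = v p := by
    intro p hp
    by_contra hne
    exact (himin p (Finset.mem_filter.2 ⟨Finset.mem_univ p, hne⟩)).not_gt hp
  -- Membership in the cyclic interval from `u i` (excluded) to `v i` (included).
  let P : ℕ → Prop := fun z =>
    ((u i : ℕ) < v i ∧ (u i : ℕ) < z ∧ z ≤ v i) ∨ ((v i : ℕ) < u i ∧ ((u i : ℕ) < z ∨ z ≤ v i))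
  have hine' : (u i : ℕ) ≠ v i := fun h => hine (Fin.ext h)
  obtain ⟨j, hj, hjmin⟩ := (Finset.univ.filter fun j => i < j ∧ P (u j)).exists_min_image id (by
    refine ⟨u.symm (v i), Finset.mem_filter.2 ⟨Finset.mem_univ _, ?_, ?_⟩⟩
    · by_contra hle
      rcases (not_lt.1 hle).eq_or_lt with h | h
      · exact hine (by rw [← h, Equiv.apply_symm_apply, h])
      · have := hpre _ h
        rw [Equiv.apply_symm_apply] at this
        exact h.ne (v.injective this.symm)
    · rw [Equiv.apply_symm_apply]
      simp only [P]
      omega)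
  obtain ⟨hij, hPj⟩ := (Finset.mem_filter.1 hj).2
  have hmid : ∀ p, i < p → p < j → ¬ P (u p) := by
    intro p hip hpj hP
    exact (hjmin p (Finset.mem_filter.2 ⟨Finset.mem_univ p, hip, hP⟩)).not_gt hpj
  have huij : (u i : ℕ) ≠ u j := fun h => hij.ne (u.injective (Fin.ext h))
  simp only [P] at hPj hmid
  -- The lattice path is not at its highest on the cyclic interval from `u i` to `u j`.
  have hgap : ∀ k, i ≤ k → k < j → ∀ x : ℕ,
      (((u i : ℕ) < u j ∧ (u i : ℕ) < x ∧ x ≤ u j) ∨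
        ((u j : ℕ) < u i ∧ ((u i : ℕ) < x ∨ x ≤ u j))) →
      gap (prefixSet u k) (prefixSet v k) x + 1 ≤ degree (prefixSet u k) (prefixSet v k) := by
    intro k hik hkj x hx
    have hc : (prefixSet u k).card = (prefixSet v k).card := by
      rw [card_prefixSet, card_prefixSet]
    refine (gap_add_one_le hc (apply_mem_prefixSet.2 hik : v i ∈ prefixSet v k) x ?_).trans
      (gap_le_degree hc _)
    intro z hz hzx
    obtain ⟨p, hp, rfl⟩ := Finset.mem_image.1 hz
    have hpk := Finset.mem_Iic.1 hp
    rw [Fin.le_def] at hzx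
    rcases lt_trichotomy p i with h | rfl | h
    · rw [hpre p h]
      exact ⟨apply_mem_prefixSet.2 hpk, fun hh => h.ne (v.injective hh)⟩
    · exfalso
      split_ifs at hzx <;> omega
    · exfalso
      have := hmid p h (hpk.trans_lt hkj)
      have hpi : (u p : ℕ) ≠ u i := fun hh => h.ne' (u.injective (Fin.ext hh))
      split_ifs at hzx <;> omega
  have hdeg : ∀ k, (degree (prefixSet (u * Equiv.swap i j) k) (prefixSet v k) : ℤ) +
      (if u j < u i then 1 else 0) * (if i ≤ k ∧ k < j then 1 else 0) ≤
      degree (prefixSet u k) (prefixSet v k) := by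
    intro k
    by_cases hk : i ≤ k ∧ k < j
    · have hg := hgap k hk.1 hk.2
      have hc : (prefixSet u k).card = (prefixSet v k).card := by
        rw [card_prefixSet, card_prefixSet]
      have hd := fun x => gap_le_degree hc x
      have hs := belowCount_prefixSet_mul_swap u hk.1 hk.2
      simp only [gap] at hg hd
      rw [if_pos hk, mul_one]
      rcases lt_or_gt_of_ne huij with h | h
      · rw [if_neg (by rw [Fin.lt_def]; omega), add_zero, Nat.cast_le, degree_le_iff]
        intro x _
        have h1 := hg x
        have h2 := hs x
        have h3 := hd x
        split_ifs at h2 <;> omega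
      · rw [if_pos (Fin.lt_def.2 h)]
        have hpos := hg 0 (by omega)
        rw [belowCount_zero, belowCount_zero] at hpos
        have : degree (prefixSet (u * Equiv.swap i j) k) (prefixSet v k) ≤
            degree (prefixSet u k) (prefixSet v k) - 1 := by
          rw [degree_le_iff]
          intro x _
          have h1 := hg x
          have h2 := hs x
          have h3 := hd x
          split_ifs at h2 <;> omega
        omega
    · rw [if_neg hk, mul_zero, add_zero, prefixSet_mul_swap_of_not_mem u hij hk]
  have hsum := Finset.sum_le_sum fun k (_ : k ∈ Finset.univ) => hdeg k
  rw [Finset.sum_add_distrib, ← Finset.mul_sum, sum_indicator_Ico] at hsum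
  refine ⟨u * Equiv.swap i j, ?_⟩
  unfold degreeDist
  rcases lt_or_gt_of_ne huij with h | h
  · have hl := permLength_mul_swap_of_cover hij (Fin.lt_def.2 h) fun k hik hkj hh => by
      have := hmid k hik hkj
      rw [Fin.lt_def, Fin.lt_def] at hh
      omega
    refine ⟨⟨i, j, hij, rfl, Or.inl hl⟩, ?_⟩
    rw [if_neg (by rw [Fin.lt_def]; omega), zero_mul, add_zero] at hsum
    omega
  · have hl := permLength_mul_swap_of_quantum hij (Fin.lt_def.2 h) fun k hik hkj => by
      have := hmid k hik hkj
      have hki : (u k : ℕ) ≠ u i := fun hh => hik.ne' (u.injective (Fin.ext hh))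
      rw [Fin.lt_def, Fin.lt_def]
      omega
    refine ⟨⟨i, j, hij, rfl, Or.inr hl⟩, ?_⟩
    rw [if_pos (Fin.lt_def.2 h), one_mul] at hsum
    omega

theorem permLength_le {n : ℕ} (w : Equiv.Perm (Fin n)) : permLength w ≤ n * n := by
  refine (Finset.card_filter_le _ _).trans ?_
  simp

theorem exists_path_le_degreeDist {n : ℕ} (N : ℕ) : ∀ u v : Equiv.Perm (Fin n),
    degreeDist u v + n * n < N → ∃ m : ℕ, (m : ℤ) ≤ degreeDist u v ∧ QBGPath m u v := by
  induction N with
  | zero =>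
    intro u v h
    -- Since `degreeDist` is bounded below, the descent along edges terminates.
    have h1 : (permLength u : ℤ) ≤ n * n := by exact_mod_cast permLength_le u
    have h2 : 0 ≤ ∑ k, (degree (prefixSet u k) (prefixSet v k) : ℤ) :=
      Finset.sum_nonneg fun k _ => Nat.cast_nonneg _
    unfold degreeDist at h
    push_cast at h
    linarith [Nat.cast_nonneg (α := ℤ) (permLength v)]
  | succ N ih =>
    intro u v h
    by_cases huv : u = v
    · subst huv
      exact ⟨0, by simp [degreeDist, degree_self], QBGPath.nil u⟩
    · obtain ⟨w, hw, hd⟩ := exists_edge_degreeDist huv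
      obtain ⟨m, hm, hp⟩ := ih w v (by push_cast at h; linarith)
      exact ⟨m + 1, by push_cast; linarith, hp.prepend hw⟩

/-- The distance in the quantum Bruhat graph is the length of a path of minimal degrees. -/
theorem qbgDist_eq {n : ℕ} (u v : Equiv.Perm (Fin n)) : (qbgDist u v : ℤ) = degreeDist u v := by
  refine le_antisymm ?_ (degreeDist_le_of_path (Nat.sInf_mem (exists_qbgPath u v)))
  obtain ⟨m, hm, hp⟩ := exists_path_le_degreeDist (degreeDist u v + n * n + 1).toNat u v (by omega)
  have : qbgDist u v ≤ m := Nat.sInf_le hp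
  omega

/-! ### Tilted intervals as order intervals -/

theorem mem_tiltedInterval_iff_degree {n : ℕ} {u v w : Equiv.Perm (Fin n)} :
    w ∈ tiltedInterval u v ↔ ∀ k, degree (prefixSet u k) (prefixSet w k) +
      degree (prefixSet w k) (prefixSet v k) = degree (prefixSet u k) (prefixSet v k) := by
  have h1 : w ∈ tiltedInterval u v ↔ degreeDist u w + degreeDist w v = degreeDist u v := by
    rw [← qbgDist_eq, ← qbgDist_eq, ← qbgDist_eq]
    exact_mod_cast Iff.rfl
  have h2 : degreeDist u w + degreeDist w v = degreeDist u v ↔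
      ∑ k, degree (prefixSet u k) (prefixSet v k) =
      ∑ k, (degree (prefixSet u k) (prefixSet w k) + degree (prefixSet w k) (prefixSet v k)) := by
    rw [Finset.sum_add_distrib]
    zify
    unfold degreeDist
    constructor <;> intro h <;> linarith
  rw [h1, h2, Finset.sum_eq_sum_iff_of_le fun k _ => degree_triangle _ _ _]
  simp [eq_comm]

theorem mem_tiltedInterval_iff {n : ℕ} {a : Fin n → Fin n} {u v w : Equiv.Perm (Fin n)}
    (h : tiltedLE a u v) : w ∈ tiltedInterval u v ↔ tiltedLE a u w ∧ tiltedLE a w v := by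
  rw [mem_tiltedInterval_iff_degree, tiltedLE, tiltedLE, ← forall_and]
  exact forall_congr' fun k => degree_add_iff (h k) (by rw [card_prefixSet, card_prefixSet])

theorem exists_tiltedLE {n : ℕ} (u v : Equiv.Perm (Fin n)) : ∃ a, tiltedLE a u v := by
  have h : ∀ k : Fin n, ∃ r, shiftedGaleLE r (prefixSet u k) (prefixSet v k) := by
    intro k
    obtain ⟨r, hr⟩ := exists_gap_eq_degree (by have := k.isLt; omega)
      (prefixSet u k) (prefixSet v k)
    exact ⟨r, shiftedGaleLE_iff.2 ⟨by rw [card_prefixSet, card_prefixSet], hr⟩⟩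
  choose a ha using h
  exact ⟨a, ha⟩

/-! ### Rank conditions on cyclic segments -/

/-- The rank conditions at a single subspace `V` of the flag that define tilted Richardson
varieties: the ranks of the initial and final segments of `<_r` are bounded by those of `A`
and `B`. -/
def SegmentRanksLE {n : ℕ} (r : Fin n) (A B : Finset (Fin n)) (V : Submodule ℂ (Fin n → ℂ)) :
    Prop :=
  ∀ i : Fin n, rankOn (cyclicIco r i) V ≤ (A ∩ cyclicIco r i).card ∧
    rankOn (cyclicIco i r) V ≤ (B ∩ cyclicIco i r).card

/-- The rank conditions of `SegmentRanksLE` with equalities. -/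
def SegmentRanksEq {n : ℕ} (r : Fin n) (A B : Finset (Fin n)) (V : Submodule ℂ (Fin n → ℂ)) :
    Prop :=
  ∀ i : Fin n, rankOn (cyclicIco r i) V = (A ∩ cyclicIco r i).card ∧
    rankOn (cyclicIco i r) V = (B ∩ cyclicIco i r).card

theorem mem_tiltedRichardsonAt_iff {n : ℕ} {u v : Equiv.Perm (Fin n)} {a : Fin n → Fin n}
    {F : CompleteFlag n} : F ∈ tiltedRichardsonAt u v a ↔
      ∀ k, SegmentRanksLE (a k) (prefixSet u k) (prefixSet v k) (F.space k) :=
  forall_comm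

theorem mem_openTiltedRichardsonAt_iff {n : ℕ} {u v : Equiv.Perm (Fin n)} {a : Fin n → Fin n}
    {F : CompleteFlag n} : F ∈ openTiltedRichardsonAt u v a ↔
      ∀ k, SegmentRanksEq (a k) (prefixSet u k) (prefixSet v k) (F.space k) :=
  forall_comm

theorem rankOn_le_iff {n : ℕ} {V : Submodule ℂ (Fin n → ℂ)} {S : Finset (Fin n)} {c : ℕ} :
    rankOn S V ≤ c ↔ ∀ C, IsRowBasis V C → (C ∩ S).card ≤ c := by
  constructor
  · exact fun h C hC => (hC.card_inter_le S).trans h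
  · intro h
    obtain ⟨C, hC, hc⟩ := exists_isRowBasis_card_inter V S
    exact hc ▸ h C hC

/-- Rank conditions say that every basis lies between `A` and `B` in the shifted Gale order. -/
theorem segmentRanksLE_iff {n : ℕ} {r : Fin n} {A B : Finset (Fin n)}
    {V : Submodule ℂ (Fin n → ℂ)} (hA : A.card = Module.finrank ℂ V)
    (hB : B.card = Module.finrank ℂ V) : SegmentRanksLE r A B V ↔
      ∀ C, IsRowBasis V C → shiftedGaleLE r A C ∧ shiftedGaleLE r C B := by
  have hfinal : ∀ C, IsRowBasis V C → ∀ i, (C ∩ cyclicIco i r).card ≤ (B ∩ cyclicIco i r).card ↔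
      (B ∩ cyclicIco r i).card ≤ (C ∩ cyclicIco r i).card := by
    intro C hC i
    rcases eq_or_ne i r with rfl | hi
    · simp [cyclicIco_self]
    · have h1 := card_inter_cyclicIco_add B hi
      have h2 := card_inter_cyclicIco_add C hi
      have h3 := hC.1
      omega
  simp only [SegmentRanksLE, rankOn_le_iff, shiftedGaleLE_iff_card_inter]
  constructor
  · intro h C hC
    exact ⟨⟨hA.trans hC.1.symm, fun i => (h i).1 C hC⟩, hC.1.trans hB.symm,
      fun i => (hfinal C hC i).1 ((h i).2 C hC)⟩
  · intro h i
    exact ⟨fun C hC => (h C hC).1.2 i, fun C hC => (hfinal C hC i).2 ((h C hC).2.2 i)⟩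

/-- A form of the rank conditions that does not involve `r`. -/
theorem segmentRanksLE_iff_degree {n : ℕ} {r : Fin n} {A B : Finset (Fin n)}
    {V : Submodule ℂ (Fin n → ℂ)} (hA : A.card = Module.finrank ℂ V)
    (hAB : shiftedGaleLE r A B) : SegmentRanksLE r A B V ↔
      ∀ C, IsRowBasis V C → degree A C + degree C B = degree A B := by
  rw [segmentRanksLE_iff hA ((shiftedGaleLE_iff.1 hAB).1.symm.trans hA)]
  exact forall₂_congr fun C hC => (degree_add_iff hAB (hC.1.trans hA.symm)).symm

/-- The greedy bases for the order `<_r` and its reverse are `A` and `B` if the ranks of the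
segments are those of `A` and `B`. -/
theorem segmentRanksEq_iff {n : ℕ} {r : Fin n} {A B : Finset (Fin n)}
    {V : Submodule ℂ (Fin n → ℂ)} (hA : A.card = Module.finrank ℂ V)
    (hB : B.card = Module.finrank ℂ V) : SegmentRanksEq r A B V ↔
      SegmentRanksLE r A B V ∧ IsRowBasis V A ∧ IsRowBasis V B := by
  constructor
  · intro h
    have hfull : ∀ f : Fin n → ℕ, (∀ x, f x < n) →
        (Finset.univ.filter fun x => f x < n) = Finset.univ :=
      fun f hf => Finset.filter_true_of_mem fun x _ => hf x
    refine ⟨fun i => ⟨(h i).1.le, (h i).2.le⟩, ⟨hA, ?_⟩, ⟨hB, ?_⟩⟩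
    · have := rankOn_eq_card_of_greedy (V := V) (A := A) (f := fun x => ((x - r : Fin n) : ℕ))
        (fun x y hxy => injective_sub_base r (Fin.ext hxy))
        (forall_initial_segment (P := fun S => rankOn S V = (A ∩ S).card)
          (by rw [rankOn_univ, Finset.inter_univ, hA]) fun i => (h i).1) n
      rwa [hfull _ fun x => (x - r).isLt, Finset.inter_univ] at this
    · -- The reverse order is increasing in `n - 1 - (x - r)`, whose initial segments are the
      -- final segments of `<_r`.
      have hrev : ∀ m, (Finset.univ.filter fun x => n - 1 - ((x - r : Fin n) : ℕ) < m) =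
          if m = 0 then cyclicIco r r else
            Finset.univ.filter fun x => n - m ≤ ((x - r : Fin n) : ℕ) := by
        intro m
        have hn := r.isLt
        split_ifs with hm
        · rw [cyclicIco_self, hm]
          simp
        · refine Finset.filter_congr fun x _ => ?_
          have := (x - r).isLt
          omega
      have := rankOn_eq_card_of_greedy (V := V) (A := B)
        (f := fun x => n - 1 - ((x - r : Fin n) : ℕ))
        (fun x y hxy => injective_sub_base r (Fin.ext (by
          have h1 := (x - r).isLt
          have h2 := (y - r).isLt
          change (x - r : Fin n).val = (y - r : Fin n).val
          simp only at hxy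
          omega)))
        (fun m => by
          rw [hrev m]
          split_ifs
          · exact (h r).2
          · exact forall_final_segment (P := fun S => rankOn S V = (B ∩ S).card)
              (by rw [rankOn_univ, Finset.inter_univ, hB]) (fun i => (h i).2) _) n
      rwa [hfull _ fun x => by have := r.isLt; omega, Finset.inter_univ] at this
  · rintro ⟨h, hA', hB'⟩ i
    exact ⟨le_antisymm (h i).1 (hA'.card_inter_le _), le_antisymm (h i).2 (hB'.card_inter_le _)⟩

/-! ### Chains of bases along a flag -/

/-- The subspace of dimension `m` of a flag (for `m ≤ n`), including `m = 0`. -/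
noncomputable def CompleteFlag.below {n : ℕ} (F : CompleteFlag n) (m : ℕ) : Submodule ℂ (Fin n → ℂ) :=
  ⨆ k : {k : Fin n // (k : ℕ) < m}, F.space k

theorem CompleteFlag.below_mono {n : ℕ} (F : CompleteFlag n) : Monotone F.below :=
  fun _ m hm => iSup_le fun k => le_iSup (fun k : {k : Fin n // (k : ℕ) < m} => F.space k)
    ⟨k.1, k.2.trans_le hm⟩

theorem CompleteFlag.below_succ {n : ℕ} (F : CompleteFlag n) {k : Fin n} {m : ℕ}
    (hm : m = (k : ℕ) + 1) : F.below m = F.space k := by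
  subst hm
  refine le_antisymm (iSup_le fun j => F.mono (Nat.le_of_lt_succ j.2)) ?_
  exact le_iSup (fun j : {j : Fin n // (j : ℕ) < (k : ℕ) + 1} => F.space j)
    ⟨k, Nat.lt_succ_self _⟩

theorem CompleteFlag.finrank_below {n : ℕ} (F : CompleteFlag n) {m : ℕ} (hm : m ≤ n) :
    Module.finrank ℂ (F.below m) = m := by
  cases m with
  | zero =>
    have : F.below 0 = ⊥ := by
      refine iSup_eq_bot.2 fun k => ?_
      exact absurd k.2 (Nat.not_lt_zero _)
    rw [this, finrank_bot]
  | succ m => rw [F.below_succ (k := ⟨m, hm⟩) rfl, F.finrank_space]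

theorem CompleteFlag.exists_chain_below {n : ℕ} (F : CompleteFlag n) (m : ℕ) :
    ∀ B, IsRowBasis (F.below m) B → ∃ C : ℕ → Finset (Fin n), C m = B ∧
      (∀ j ≤ m, IsRowBasis (F.below j) (C j)) ∧ ∀ j < m, C j ⊆ C (j + 1) := by
  induction m with
  | zero =>
    intro B hB
    refine ⟨fun _ => B, rfl, fun j hj => ?_, fun j hj => absurd hj (Nat.not_lt_zero _)⟩
    rwa [Nat.le_zero.1 hj]
  | succ m ih =>
    intro B hB
    obtain ⟨D, hDB, hD⟩ := hB.exists_subset (F.below_mono (Nat.le_succ m))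
    obtain ⟨C, hC, hbasis, hchain⟩ := ih D hD
    refine ⟨fun j => if j ≤ m then C j else B, by simp, fun j hj => ?_, fun j hj => ?_⟩
    · rcases hj.lt_or_eq with h | rfl
      · simpa [Nat.le_of_lt_succ h] using hbasis j (Nat.le_of_lt_succ h)
      · simpa using hB
    · rcases (Nat.le_of_lt_succ hj).lt_or_eq with h | rfl
      · simpa [h.le, Nat.succ_le_of_lt h] using hchain j h
      · simpa [hC] using hDB

theorem CompleteFlag.exists_chain {n : ℕ} (F : CompleteFlag n) {k m : ℕ} (hkm : k ≤ m)
    {B : Finset (Fin n)} (hB : IsRowBasis (F.below k) B) :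
    ∃ C : ℕ → Finset (Fin n), C k = B ∧
      (∀ j ≤ m, IsRowBasis (F.below j) (C j)) ∧ ∀ j < m, C j ⊆ C (j + 1) := by
  induction m, hkm using Nat.le_induction with
  | base => exact F.exists_chain_below k B hB
  | succ m hkm ih =>
    obtain ⟨C, hC, hbasis, hchain⟩ := ih
    obtain ⟨D, hCD, hD⟩ := (hbasis m le_rfl).exists_superset (F.below_mono (Nat.le_succ m))
    refine ⟨fun j => if j ≤ m then C j else D, by simp [hkm, hC], fun j hj => ?_, fun j hj => ?_⟩
    · rcases hj.lt_or_eq with h | rfl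
      · simpa [Nat.le_of_lt_succ h] using hbasis j (Nat.le_of_lt_succ h)
      · simpa using hD
    · rcases (Nat.le_of_lt_succ hj).lt_or_eq with h | rfl
      · simpa [h.le, Nat.succ_le_of_lt h] using hchain j h
      · simpa using hCD

/-- Every basis of a member of a flag is a prefix of a permutation whose multi-Plücker coordinate
does not vanish. -/
theorem CompleteFlag.exists_perm {n : ℕ} (F : CompleteFlag n) {k : Fin n} {B : Finset (Fin n)}
    (hB : IsRowBasis (F.space k) B) :
    ∃ w : Equiv.Perm (Fin n), prefixSet w k = B ∧ multiPlucker F w ≠ 0 := by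
  rw [← F.below_succ rfl] at hB
  obtain ⟨C, hC, hbasis, hchain⟩ := F.exists_chain (m := n) (k := (k : ℕ) + 1) k.isLt hB
  have hcard : ∀ j ≤ n, (C j).card = j := fun j hj => (hbasis j hj).1.trans (F.finrank_below hj)
  have hmono : ∀ i j, i ≤ j → j ≤ n → C i ⊆ C j := by
    intro i j hij
    induction j, hij using Nat.le_induction with
    | base => exact fun _ => Finset.Subset.refl _
    | succ j _ ih => exact fun hj => (ih (by omega)).trans (hchain j hj)
  have hex : ∀ j : Fin n, ∃ x ∈ C ((j : ℕ) + 1), x ∉ C j := by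
    intro j
    refine Finset.exists_mem_notMem_of_card_lt_card ?_
    rw [hcard _ j.isLt.le, hcard _ j.isLt]
    exact Nat.lt_succ_self _
  choose f hf hf' using hex
  have hlt : ∀ i j, i < j → f i ≠ f j := by
    intro i j hij h
    exact hf' j (h ▸ hmono _ _ (Nat.succ_le_of_lt hij) j.isLt.le (hf i))
  have hinj : Function.Injective f := by
    intro i j h
    by_contra hne
    rcases lt_or_gt_of_ne hne with h' | h'
    · exact hlt i j h' h
    · exact hlt j i h' h.symm
  let w : Equiv.Perm (Fin n) := Equiv.ofBijective f (Finite.injective_iff_bijective.1 hinj)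
  have hw : ∀ j, prefixSet w j = C ((j : ℕ) + 1) := by
    intro j
    refine Finset.eq_of_subset_of_card_le (fun x hx => ?_)
      (by rw [card_prefixSet, hcard _ j.isLt])
    obtain ⟨p, hp, rfl⟩ := Finset.mem_image.1 hx
    exact hmono _ _ (Nat.succ_le_succ (Fin.le_def.1 (Finset.mem_Iic.1 hp))) j.isLt (hf p)
  refine ⟨w, (hw k).trans hC, (multiPlucker_ne_zero_iff F w).2 fun j => ?_⟩
  rw [hw, ← F.below_succ rfl]
  exact hbasis _ j.isLt

/-! ### Tilted Richardson varieties by Plücker coordinates -/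

theorem CompleteFlag.card_prefixSet_eq {n : ℕ} (F : CompleteFlag n) (w : Equiv.Perm (Fin n))
    (k : Fin n) : (prefixSet w k).card = Module.finrank ℂ (F.space k) := by
  rw [card_prefixSet, F.finrank_space]

theorem mem_tiltedRichardsonAt_iff_multiPlucker {n : ℕ} {u v : Equiv.Perm (Fin n)}
    {a : Fin n → Fin n} (h : tiltedLE a u v) {F : CompleteFlag n} :
    F ∈ tiltedRichardsonAt u v a ↔ ∀ w ∉ tiltedInterval u v, multiPlucker F w = 0 := by
  have h1 : F ∈ tiltedRichardsonAt u v a ↔ ∀ k C, IsRowBasis (F.space k) C →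
      shiftedGaleLE (a k) (prefixSet u k) C ∧ shiftedGaleLE (a k) C (prefixSet v k) := by
    rw [mem_tiltedRichardsonAt_iff]
    exact forall_congr' fun k =>
      segmentRanksLE_iff (F.card_prefixSet_eq u k) (F.card_prefixSet_eq v k)
  rw [h1]
  constructor
  · intro hF w
    contrapose!
    intro hw
    rw [mem_tiltedInterval_iff h]
    have hw' := (multiPlucker_ne_zero_iff F w).1 hw
    exact ⟨fun k => (hF k _ (hw' k)).1, fun k => (hF k _ (hw' k)).2⟩
  · intro hF k C hC
    obtain ⟨w, rfl, hw⟩ := F.exists_perm hC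
    have hmem : w ∈ tiltedInterval u v := by
      by_contra hmem
      exact hw (hF w hmem)
    obtain ⟨h2, h3⟩ := (mem_tiltedInterval_iff h).1 hmem
    exact ⟨h2 k, h3 k⟩

theorem mem_openTiltedRichardsonAt_iff_multiPlucker {n : ℕ} {u v : Equiv.Perm (Fin n)}
    {a : Fin n → Fin n} {F : CompleteFlag n} : F ∈ openTiltedRichardsonAt u v a ↔
      F ∈ tiltedRichardsonAt u v a ∧ multiPlucker F u * multiPlucker F v ≠ 0 := by
  rw [mem_openTiltedRichardsonAt_iff, mem_tiltedRichardsonAt_iff, mul_ne_zero_iff,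
    multiPlucker_ne_zero_iff, multiPlucker_ne_zero_iff, ← forall_and, ← forall_and]
  exact forall_congr' fun k =>
    segmentRanksEq_iff (F.card_prefixSet_eq u k) (F.card_prefixSet_eq v k)

theorem tiltedRichardson_eq {n : ℕ} {u v : Equiv.Perm (Fin n)} {a : Fin n → Fin n}
    (h : tiltedLE a u v) : tiltedRichardson u v = tiltedRichardsonAt u v a := by
  ext F
  constructor
  · rintro ⟨b, hb, hF⟩
    exact (mem_tiltedRichardsonAt_iff_multiPlucker h).2
      ((mem_tiltedRichardsonAt_iff_multiPlucker hb).1 hF)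
  · exact fun hF => ⟨a, h, hF⟩

theorem openTiltedRichardson_eq {n : ℕ} {u v : Equiv.Perm (Fin n)} {a : Fin n → Fin n}
    (h : tiltedLE a u v) : openTiltedRichardson u v = openTiltedRichardsonAt u v a := by
  ext F
  constructor
  · rintro ⟨b, hb, hF⟩
    rw [mem_openTiltedRichardsonAt_iff_multiPlucker,
      mem_tiltedRichardsonAt_iff_multiPlucker hb] at hF
    rwa [mem_openTiltedRichardsonAt_iff_multiPlucker, mem_tiltedRichardsonAt_iff_multiPlucker h]
  · exact fun hF => ⟨a, h, hF⟩

/-! ### Rotated Grassmannian Richardson varieties -/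

theorem rankOn_image_map {n : ℕ} (e : Equiv.Perm (Fin n)) (S : Finset (Fin n))
    (V : Submodule ℂ (Fin n → ℂ)) :
    rankOn (S.image e) (V.map (LinearEquiv.funCongrLeft ℂ ℂ e.symm).toLinearMap) =
      rankOn S V := by
  let f : S ≃ (S.image e : Finset (Fin n)) := Equiv.ofBijective
    (fun x => ⟨e x, Finset.mem_image_of_mem e x.2⟩) ⟨fun x y hxy => by
      exact Subtype.ext (e.injective (congrArg Subtype.val hxy)), fun ⟨y, hy⟩ => by
      obtain ⟨x, hx, rfl⟩ := Finset.mem_image.1 hy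
      exact ⟨⟨x, hx⟩, rfl⟩⟩
  have hmap : V.map (LinearMap.funLeft ℂ ℂ (Subtype.val : S → Fin n)) =
      ((V.map (LinearEquiv.funCongrLeft ℂ ℂ e.symm).toLinearMap).map
        (LinearMap.funLeft ℂ ℂ (Subtype.val : ↥(S.image e) → Fin n))).map
        (LinearEquiv.funCongrLeft ℂ ℂ f).toLinearMap := by
    rw [← Submodule.map_comp, ← Submodule.map_comp]
    congr 1
    refine LinearMap.ext fun x => funext fun s => ?_
    change x s = x (e.symm (e s))
    rw [e.symm_apply_apply]
  rw [rankOn, rankOn, hmap, LinearEquiv.finrank_map_eq]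

theorem rankOn_grRotate_iterate {n k : ℕ} (m : ℕ) (S : Finset (Fin n)) (V : Gr k n) :
    rankOn (S.image ((finRotate n)^[m])) (grRotate^[m] V).1 = rankOn S V.1 := by
  induction m with
  | zero => simp
  | succ m ih =>
    rw [Function.iterate_succ_apply', Function.iterate_succ', ← Finset.image_image, ← ih]
    exact rankOn_image_map (finRotate n) _ _

theorem grRotate_surjective {n k : ℕ} : Function.Surjective (grRotate : Gr k n → Gr k n) := by
  intro V
  refine ⟨⟨V.1.map (LinearEquiv.funCongrLeft ℂ ℂ (finRotate n)).toLinearMap, by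
    rw [LinearEquiv.finrank_map_eq]; exact V.2⟩, Subtype.ext ?_⟩
  change (V.1.map _).map _ = V.1
  rw [← Submodule.map_comp]
  convert Submodule.map_id V.1 using 2
  refine LinearMap.ext fun x => funext fun y => ?_
  change x (finRotate n ((finRotate n).symm y)) = x y
  rw [Equiv.apply_symm_apply]

theorem card_rotateSetInv_inter {n : ℕ} (m : ℕ) (I S : Finset (Fin n)) :
    (rotateSetInv m I ∩ S).card = (I ∩ S.image ((finRotate n)^[m])).card := by
  have hleft : Function.LeftInverse ((finRotate n).symm^[m]) ((finRotate n)^[m]) :=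
    Function.LeftInverse.iterate (finRotate n).left_inv m
  have hright : Function.LeftInverse ((finRotate n)^[m]) ((finRotate n).symm^[m]) :=
    Function.LeftInverse.iterate (finRotate n).right_inv m
  rw [← Finset.card_image_of_injective _ hleft.injective,
    Finset.image_inter _ _ hleft.injective, rotateSetInv, Finset.image_image,
    hright.comp_eq_id, Finset.image_id]

theorem finRotate_iterate_apply {n : ℕ} (r x : Fin n) :
    ((finRotate n)^[(r : ℕ)]) x = x + r := by
  obtain ⟨n, rfl⟩ : ∃ m, n = m + 1 := ⟨n - 1, by have := r.isLt; omega⟩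
  have h : ∀ m : ℕ, (((finRotate (n + 1))^[m]) x : ℕ) = ((x : ℕ) + m) % (n + 1) := by
    intro m
    induction m with
    | zero => rw [Function.iterate_zero_apply, add_zero, Nat.mod_eq_of_lt x.isLt]
    | succ m ih =>
      rw [Function.iterate_succ_apply', finRotate_apply, Fin.val_add, ih, Fin.val_one',
        ← Nat.add_mod, add_assoc]
  exact Fin.ext ((h r).trans (Fin.val_add x r).symm)

theorem image_finRotate_iterate {n : ℕ} (r : Fin n) (S : Finset (Fin n)) :
    S.image ((finRotate n)^[(r : ℕ)]) = Finset.univ.filter fun x => x - r ∈ S := by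
  have : NeZero n := ⟨by have := r.isLt; omega⟩
  ext x
  simp only [Finset.mem_image, finRotate_iterate_apply, Finset.mem_filter, Finset.mem_univ,
    true_and]
  constructor
  · rintro ⟨y, hy, rfl⟩
    simpa using hy
  · exact fun h => ⟨x - r, h, sub_add_cancel _ _⟩

theorem forall_image_Ici_iff {n : ℕ} {P : Finset (Fin n) → Prop} {r : Fin n} (hempty : P ∅)
    (huniv : P Finset.univ) :
    (∀ i, P ((Finset.Ici i).image ((finRotate n)^[(r : ℕ)]))) ↔ ∀ i, P (cyclicIco i r) := by
  have heq : ∀ i : Fin n, (Finset.Ici i).image ((finRotate n)^[(r : ℕ)]) =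
      Finset.univ.filter fun x => (i : ℕ) ≤ ((x - r : Fin n) : ℕ) := by
    intro i
    rw [image_finRotate_iterate]
    simp only [Finset.mem_Ici, Fin.le_def]
  constructor
  · intro h i
    rcases eq_or_ne i r with rfl | hi
    · rwa [cyclicIco_self]
    · have := h (i - r)
      rw [heq] at this
      convert this using 1
      ext x
      rw [mem_cyclicIco_right, Finset.mem_filter, Fin.le_def]
      simp [hi]
  · intro h i
    rw [heq]
    exact forall_final_segment huniv h _

theorem forall_image_Iic_iff {n : ℕ} {P : Finset (Fin n) → Prop} {r : Fin n} (hempty : P ∅)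
    (huniv : P Finset.univ) :
    (∀ i, P ((Finset.Iic i).image ((finRotate n)^[(r : ℕ)]))) ↔ ∀ i, P (cyclicIco r i) := by
  have heq : ∀ i : Fin n, (Finset.Iic i).image ((finRotate n)^[(r : ℕ)]) =
      Finset.univ.filter fun x => ((x - r : Fin n) : ℕ) < (i : ℕ) + 1 := by
    intro i
    rw [image_finRotate_iterate]
    simp only [Finset.mem_Iic, Fin.le_def, Nat.lt_succ_iff]
  constructor
  · intro h i
    by_cases hi : ((i - r : Fin n) : ℕ) = 0
    · have : cyclicIco r i = ∅ := by
        ext x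
        rw [mem_cyclicIco, Fin.lt_def, hi]
        simp
      rwa [this]
    · have := h ⟨((i - r : Fin n) : ℕ) - 1, by have := (i - r).isLt; omega⟩
      rw [heq] at this
      convert this using 1
      ext x
      rw [mem_cyclicIco, Finset.mem_filter, Fin.lt_def]
      simp only [Finset.mem_univ, true_and]
      omega
  · intro h i
    rw [heq]
    exact forall_initial_segment huniv h _

/-- Both rotated Grassmannian Richardson varieties at once: `R` is `≤` or `=`. -/
theorem exists_grRotate_iff {n k : ℕ} {R : ℕ → ℕ → Prop} (hR : ∀ x, R x x)
    {I J : Finset (Fin n)} (hI : I.card = k) (hJ : J.card = k) (r : Fin n) (V : Gr k n) :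
    (∃ W : Gr k n, ((∀ i, R (rankOn (Finset.Ici i) W.1) (rotateSetInv r J ∩ Finset.Ici i).card) ∧
        ∀ i, R (rankOn (Finset.Iic i) W.1) (rotateSetInv r I ∩ Finset.Iic i).card) ∧
        grRotate^[(r : ℕ)] W = V) ↔
      ∀ i, R (rankOn (cyclicIco r i) V.1) (I ∩ cyclicIco r i).card ∧
        R (rankOn (cyclicIco i r) V.1) (J ∩ cyclicIco i r).card := by
  have hempty : ∀ A : Finset (Fin n), R (rankOn ∅ V.1) (A ∩ ∅).card := by
    intro A
    have h0 : rankOn (∅ : Finset (Fin n)) V.1 = 0 := Nat.le_zero.1 (rankOn_le_card _ _)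
    rw [h0, Finset.inter_empty, Finset.card_empty]
    exact hR 0
  have huniv : ∀ A : Finset (Fin n), A.card = k →
      R (rankOn Finset.univ V.1) (A ∩ Finset.univ).card := by
    intro A hA
    rw [rankOn_univ, V.2, Finset.inter_univ, hA]
    exact hR k
  rw [forall_and, ← forall_image_Ici_iff (P := fun S => R (rankOn S V.1) (J ∩ S).card)
    (hempty J) (huniv J hJ), ← forall_image_Iic_iff
    (P := fun S => R (rankOn S V.1) (I ∩ S).card) (hempty I) (huniv I hI)]
  simp only [card_rotateSetInv_inter]
  constructor
  · rintro ⟨W, ⟨h1, h2⟩, rfl⟩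
    simp only [rankOn_grRotate_iterate]
    exact ⟨h2, h1⟩
  · rintro ⟨h2, h1⟩
    obtain ⟨W, rfl⟩ := grRotate_surjective.iterate (r : ℕ) V
    simp only [rankOn_grRotate_iterate] at h1 h2
    exact ⟨W, ⟨h1, h2⟩, rfl⟩

theorem mem_rotatedRichardson_iff {n k : ℕ} {I J : Finset (Fin n)} (hI : I.card = k)
    (hJ : J.card = k) (r : Fin n) (V : Gr k n) :
    V ∈ rotatedRichardson k I J r ↔ SegmentRanksLE r I J V.1 :=
  exists_grRotate_iff (R := (· ≤ ·)) le_refl hI hJ r V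

theorem mem_rotatedOpenRichardson_iff {n k : ℕ} {I J : Finset (Fin n)} (hI : I.card = k)
    (hJ : J.card = k) (r : Fin n) (V : Gr k n) :
    V ∈ rotatedOpenRichardson k I J r ↔ SegmentRanksEq r I J V.1 :=
  exists_grRotate_iff (R := (· = ·)) (fun _ => rfl) hI hJ r V

/-- The last member of the flag satisfies all the rank conditions. -/
theorem segmentRanksEq_last {n : ℕ} (F : CompleteFlag n) (u v : Equiv.Perm (Fin n)) (r k : Fin n)
    (hk : ¬ (k : ℕ) + 1 < n) :
    SegmentRanksEq r (prefixSet u k) (prefixSet v k) (F.space k) := by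
  have hkn : (k : ℕ) + 1 = n := by have := k.isLt; omega
  have htop : F.space k = ⊤ := Submodule.eq_top_of_finrank_eq (by
    rw [F.finrank_space, hkn, Module.finrank_fin_fun])
  have hpre : ∀ w : Equiv.Perm (Fin n), prefixSet w k = Finset.univ := fun w =>
    Finset.eq_univ_of_card _ (by rw [card_prefixSet, hkn, Fintype.card_fin])
  have hbasis : IsRowBasis (F.space k) Finset.univ :=
    ⟨by rw [htop]; simp, by rw [rankOn_univ, htop]; simp⟩
  have hrank : ∀ S, rankOn S (F.space k) = (Finset.univ ∩ S).card := fun S =>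
    le_antisymm (by rw [Finset.univ_inter]; exact rankOn_le_card _ _) (hbasis.card_inter_le S)
  intro i
  rw [hpre, hpre]
  exact ⟨hrank _, hrank _⟩

theorem SegmentRanksEq.le {n : ℕ} {r : Fin n} {A B : Finset (Fin n)}
    {V : Submodule ℂ (Fin n → ℂ)} (h : SegmentRanksEq r A B V) : SegmentRanksLE r A B V :=
  fun i => ⟨(h i).1.le, (h i).2.le⟩

theorem tiltedRichardsonAt_eq_iInter {n : ℕ} (u v : Equiv.Perm (Fin n)) (a : Fin n → Fin n) :
    tiltedRichardsonAt u v a =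
      ⋂ (k : Fin n) (_ : (k : ℕ) + 1 < n), CompleteFlag.proj k ⁻¹'
        rotatedRichardson ((k : ℕ) + 1) (prefixSet u k) (prefixSet v k) (a k) := by
  ext F
  simp only [Set.mem_iInter, Set.mem_preimage, mem_tiltedRichardsonAt_iff,
    mem_rotatedRichardson_iff (card_prefixSet u _) (card_prefixSet v _)]
  refine forall_congr' fun k => ⟨fun h _ => h, fun h => ?_⟩
  by_cases hk : (k : ℕ) + 1 < n
  · exact h hk
  · exact (segmentRanksEq_last F u v (a k) k hk).le

theorem openTiltedRichardsonAt_eq_iInter {n : ℕ} (u v : Equiv.Perm (Fin n)) (a : Fin n → Fin n) :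
    openTiltedRichardsonAt u v a =
      ⋂ (k : Fin n) (_ : (k : ℕ) + 1 < n), CompleteFlag.proj k ⁻¹'
        rotatedOpenRichardson ((k : ℕ) + 1) (prefixSet u k) (prefixSet v k) (a k) := by
  ext F
  simp only [Set.mem_iInter, Set.mem_preimage, mem_openTiltedRichardsonAt_iff,
    mem_rotatedOpenRichardson_iff (card_prefixSet u _) (card_prefixSet v _)]
  refine forall_congr' fun k => ⟨fun h _ => h, fun h => ?_⟩
  by_cases hk : (k : ℕ) + 1 < n
  · exact h hk
  · exact segmentRanksEq_last F u v (a k) k hk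

/-! ### Tilted Schubert cells -/

theorem prefixSet_eq_insert {n : ℕ} (w : Equiv.Perm (Fin n)) (k : Fin n) :
    prefixSet w k = insert (w k) ((Finset.Iio k).image w) := by
  rw [prefixSet, ← Finset.Iio_insert k, Finset.image_insert]

theorem apply_notMem_image_Iio {n : ℕ} {w : Equiv.Perm (Fin n)} {p k : Fin n} (h : k ≤ p) :
    w p ∉ (Finset.Iio k).image w := by
  simpa using h

/-- Replacing `x` by an element of `S` breaks the rank bound for `S` given by a set through `x`,
if `x ∉ S`. -/
theorem not_isRowBasis_of_rankOn_le {n : ℕ} {V : Submodule ℂ (Fin n → ℂ)}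
    {I S : Finset (Fin n)} {x y : Fin n} (h : rankOn S V ≤ (insert x I ∩ S).card) (hx : x ∉ S)
    (hy : y ∈ S) (hyI : y ∉ I) : ¬ IsRowBasis V (insert y I) := by
  intro hB
  have h1 := (hB.card_inter_le S).trans h
  rw [Finset.insert_inter_of_mem hy, Finset.insert_inter_of_notMem hx,
    Finset.card_insert_of_notMem fun hh => hyI (Finset.mem_inter.1 hh).1] at h1
  omega

/-- The rank bound for `S` passes from `V` to the next member `W` of the flag. -/
theorem IsRowBasis.rankOn_le_insert {n : ℕ} {V W : Submodule ℂ (Fin n → ℂ)} (hVW : V ≤ W)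
    (hrank : Module.finrank ℂ W = Module.finrank ℂ V + 1) {B S : Finset (Fin n)} {x : Fin n}
    (hB : IsRowBasis V B) (hx : x ∉ B) (hV : rankOn S V ≤ (B ∩ S).card)
    (h : x ∉ S → ∀ y ∈ S, y ∉ B → ¬ IsRowBasis W (insert y B)) :
    rankOn S W ≤ (insert x B ∩ S).card := by
  by_cases hxS : x ∈ S
  · rw [Finset.insert_inter_of_mem hxS,
      Finset.card_insert_of_notMem fun hh => hx (Finset.mem_inter.1 hh).1]
    exact (rankOn_le_add_one S hVW hrank).trans (Nat.add_le_add_right hV 1)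
  · rw [Finset.insert_inter_of_notMem hxS]
    refine (hB.rankOn_le_of_forall hVW fun y hy hyB hr => h hxS y hy hyB ⟨?_, hr⟩).trans hV
    rw [Finset.card_insert_of_notMem hyB, hB.1, hrank]

theorem openTiltedRichardson_subset {n : ℕ} {u v : Equiv.Perm (Fin n)} {a : Fin n → Fin n}
    (h : tiltedLE a u v) :
    openTiltedRichardson u v ⊆ tiltedSchubertCell v a ∩ oppTiltedSchubertCell u a := by
  intro F hF
  rw [openTiltedRichardson_eq h, mem_openTiltedRichardsonAt_iff_multiPlucker] at hF
  obtain ⟨hF, hne⟩ := hF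
  obtain ⟨hu, hv⟩ := mul_ne_zero_iff.1 hne
  rw [mem_tiltedRichardsonAt_iff] at hF
  refine ⟨⟨hv, ?_⟩, hu, ?_⟩
  · rintro i k ⟨p, k', hpk, hkp, hlt⟩
    obtain ⟨rfl, rfl⟩ := Prod.mk.injEq .. ▸ hpk
    by_contra hpl
    have hr := (hF k (v p)).2
    rw [prefixSet_eq_insert] at hr
    refine not_isRowBasis_of_rankOn_le hr ?_ ?_ (apply_notMem_image_Iio hkp.le)
      ((plucker_update_ne_zero_iff F v hkp).1 hpl)
    · rw [mem_cyclicIco_right, not_and, not_le]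
      exact fun _ => hlt
    · rw [mem_cyclicIco_right]
      refine ⟨fun hh => ?_, le_rfl⟩
      have : NeZero n := ⟨by have := k.isLt; omega⟩
      have hlt' : v k - a k < v p - a k := hlt
      rw [hh, sub_self] at hlt'
      exact Fin.not_lt_zero _ hlt'
  · rintro i k ⟨p, k', hpk, hkp, hlt⟩
    obtain ⟨rfl, rfl⟩ := Prod.mk.injEq .. ▸ hpk
    by_contra hpl
    have hr := (hF k (u k)).1
    rw [prefixSet_eq_insert] at hr
    refine not_isRowBasis_of_rankOn_le hr ?_ ?_ (apply_notMem_image_Iio hkp.le)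
      ((plucker_update_ne_zero_iff F u hkp).1 hpl)
    · rw [mem_cyclicIco]
      exact lt_irrefl _
    · rw [mem_cyclicIco]
      exact hlt

theorem isRowBasis_below {n : ℕ} {F : CompleteFlag n} {w : Equiv.Perm (Fin n)}
    (hw : multiPlucker F w ≠ 0) (k : Fin n) :
    IsRowBasis (F.below k) ((Finset.Iio k).image w) := by
  have hcard : ((Finset.Iio k).image w).card = k := by
    rw [Finset.card_image_of_injective _ w.injective, Fin.card_Iio]
  refine ⟨hcard.trans (F.finrank_below k.isLt.le).symm, ?_⟩
  by_cases hk : (k : ℕ) = 0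
  · have : (Finset.Iio k).image w = ∅ := Finset.card_eq_zero.1 (hcard.trans hk)
    rw [this]
    exact Nat.le_zero.1 (rankOn_le_card _ _)
  · obtain ⟨j, hj⟩ : ∃ j : Fin n, (k : ℕ) = (j : ℕ) + 1 := ⟨⟨k - 1, by omega⟩, by simp; omega⟩
    have hset : Finset.Iio k = Finset.Iic j := by
      ext x
      rw [Finset.mem_Iio, Finset.mem_Iic, Fin.lt_def, Fin.le_def]
      omega
    rw [F.below_succ hj, hset]
    exact ((multiPlucker_ne_zero_iff F w).1 hw j).2

/-- The rank conditions propagate along the flag: by `u ∼_a v`, the index `a_k` may be replaced by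
`a_{k+1}` in the conditions on `F_k`, and the vanishing coordinates carry them over to `F_{k+1}`. -/
theorem segmentRanksLE_of_mem_cells {n : ℕ} {u v : Equiv.Perm (Fin n)} {a : Fin n → Fin n}
    (h : tiltedLesssim a u v) {F : CompleteFlag n}
    (hF : F ∈ tiltedSchubertCell v a ∩ oppTiltedSchubertCell u a) (m : ℕ) : ∀ k : Fin n,
    (k : ℕ) = m → SegmentRanksLE (a k) (prefixSet u k) (prefixSet v k) (F.space k) := by
  obtain ⟨⟨hv, hvan⟩, hu, huan⟩ := hF
  -- Passing from `F.below k` to `F.space k`.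
  have hstep : ∀ k : Fin n, SegmentRanksLE (a k) ((Finset.Iio k).image u)
      ((Finset.Iio k).image v) (F.below k) →
      SegmentRanksLE (a k) (prefixSet u k) (prefixSet v k) (F.space k) := by
    intro k hk i
    have hle : F.below k ≤ F.space k := by
      rw [← F.below_succ rfl]
      exact F.below_mono (Nat.le_succ _)
    have hrank : Module.finrank ℂ (F.space k) = Module.finrank ℂ (F.below k) + 1 := by
      rw [F.finrank_space, F.finrank_below k.isLt.le]
    have hlater : ∀ (w : Equiv.Perm (Fin n)) (S : Finset (Fin n)), w k ∉ S → ∀ y ∈ S,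
        y ∉ (Finset.Iio k).image w → ∃ p, k < p ∧ w p = y := by
      intro w S hk y hy hyw
      refine ⟨w.symm y, ?_, w.apply_symm_apply y⟩
      refine lt_of_le_of_ne (not_lt.1 fun hlt => hyw ?_) fun hh => hk ?_
      · exact Finset.mem_image.2 ⟨w.symm y, Finset.mem_Iio.2 hlt, w.apply_symm_apply y⟩
      · rwa [hh, w.apply_symm_apply]
    rw [prefixSet_eq_insert, prefixSet_eq_insert]
    constructor
    · refine (isRowBasis_below hu k).rankOn_le_insert hle hrank (apply_notMem_image_Iio le_rfl)
        (hk i).1 fun hkS y hy hyB => ?_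
      obtain ⟨p, hkp, rfl⟩ := hlater u _ hkS y hy hyB
      rw [← plucker_update_ne_zero_iff F u hkp, not_not]
      refine huan _ _ ⟨p, k, rfl, hkp, ?_⟩
      rw [mem_cyclicIco] at hkS hy
      exact hy.trans_le (not_lt.1 hkS)
    · refine (isRowBasis_below hv k).rankOn_le_insert hle hrank (apply_notMem_image_Iio le_rfl)
        (hk i).2 fun hkS y hy hyB => ?_
      obtain ⟨p, hkp, rfl⟩ := hlater v _ hkS y hy hyB
      rw [← plucker_update_ne_zero_iff F v hkp, not_not]
      refine hvan _ _ ⟨p, k, rfl, hkp, ?_⟩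
      rw [mem_cyclicIco_right] at hkS hy
      exact (not_le.1 fun hh => hkS ⟨hy.1, hh⟩).trans_le hy.2
  induction m with
  | zero =>
    intro k hk
    refine hstep k fun i => ?_
    have h0 : ∀ S, rankOn S (F.below k) = 0 := fun S => by
      have := rankOn_le_finrank S (F.below k)
      rw [F.finrank_below k.isLt.le] at this
      omega
    rw [h0, h0]
    exact ⟨Nat.zero_le _, Nat.zero_le _⟩
  | succ m ih =>
    intro k hk
    refine hstep k ?_
    obtain ⟨j, hj⟩ : ∃ j : Fin n, (j : ℕ) = m := ⟨⟨m, by omega⟩, rfl⟩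
    have hkj : (k : ℕ) = (j : ℕ) + 1 := by omega
    have hset : Finset.Iio k = Finset.Iic j := by
      ext x
      rw [Finset.mem_Iio, Finset.mem_Iic, Fin.lt_def, Fin.le_def]
      omega
    have hprev := ih j hj
    rw [segmentRanksLE_iff_degree (F.card_prefixSet_eq u j) (h.1 j)] at hprev
    rw [F.below_succ hkj, hset]
    exact (segmentRanksLE_iff_degree (F.card_prefixSet_eq u j)
      (shiftedGaleLE_of_card_inter_eq (h.1 j) (h.2 j k hkj))).2 hprev

theorem openTiltedRichardson_eq_inter_cells {n : ℕ} {u v : Equiv.Perm (Fin n)}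
    {a : Fin n → Fin n} (h : tiltedLesssim a u v) :
    openTiltedRichardson u v = tiltedSchubertCell v a ∩ oppTiltedSchubertCell u a := by
  refine (openTiltedRichardson_subset h.1).antisymm fun F hF => ?_
  rw [openTiltedRichardson_eq h.1, mem_openTiltedRichardsonAt_iff_multiPlucker,
    mem_tiltedRichardsonAt_iff]
  exact ⟨fun k => segmentRanksLE_of_mem_cells h hF k k rfl, mul_ne_zero hF.2.1 hF.1.1⟩

end TiltedRichardson

open TiltedRichardson
theorem mainTheorem10 (n : ℕ) (u v : Equiv.Perm (Fin n)) :
    -- `T_{u,v}` and `T°_{u,v}` are well defined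
    (∃ a : Fin n → Fin n, tiltedLE a u v) ∧
    (∀ a : Fin n → Fin n, tiltedLE a u v →
      tiltedRichardson u v = tiltedRichardsonAt u v a ∧
      openTiltedRichardson u v = openTiltedRichardsonAt u v a) ∧
    -- intersections of preimages of cyclically rotated Grassmannian Richardson varieties
    (∀ a : Fin n → Fin n,
      tiltedRichardsonAt u v a =
        ⋂ (k : Fin n) (_ : (k : ℕ) + 1 < n), CompleteFlag.proj k ⁻¹'
          rotatedRichardson ((k : ℕ) + 1) (prefixSet u k) (prefixSet v k) (a k) ∧
      openTiltedRichardsonAt u v a =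
        ⋂ (k : Fin n) (_ : (k : ℕ) + 1 < n), CompleteFlag.proj k ⁻¹'
          rotatedOpenRichardson ((k : ℕ) + 1) (prefixSet u k) (prefixSet v k) (a k)) ∧
    -- multi-Plücker coordinates
    tiltedRichardson u v =
      {F : CompleteFlag n | ∀ w : Equiv.Perm (Fin n), w ∉ tiltedInterval u v →
        multiPlucker F w = 0} ∧
    openTiltedRichardson u v =
      tiltedRichardson u v ∩ {F : CompleteFlag n | multiPlucker F u * multiPlucker F v ≠ 0} ∧
    -- tilted Schubert cells
    (∀ a : Fin n → Fin n,
      (tiltedLE a u v →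
        openTiltedRichardson u v ⊆ tiltedSchubertCell v a ∩ oppTiltedSchubertCell u a) ∧
      (tiltedLesssim a u v →
        openTiltedRichardson u v = tiltedSchubertCell v a ∩ oppTiltedSchubertCell u a)) := by
  obtain ⟨b, hb⟩ := exists_tiltedLE u v
  refine ⟨⟨b, hb⟩, fun a ha => ⟨tiltedRichardson_eq ha, openTiltedRichardson_eq ha⟩,
    fun a => ⟨tiltedRichardsonAt_eq_iInter u v a, openTiltedRichardsonAt_eq_iInter u v a⟩, ?_, ?_,
    fun a => ⟨openTiltedRichardson_subset, openTiltedRichardson_eq_inter_cells⟩⟩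
  · rw [tiltedRichardson_eq hb]
    ext F
    exact mem_tiltedRichardsonAt_iff_multiPlucker hb
  · rw [openTiltedRichardson_eq hb, tiltedRichardson_eq hb]
    ext F
    exact mem_openTiltedRichardsonAt_iff_multiPlucker
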